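/- Let $M$ be a connected closed surface with a triangulation $\mathcal T=(V,E,F)$ (a finite simplicial complex), $V=\{1,\dots,N\}$, and let $\Phi:E\to[0,\frac{\pi}{2}]$ be a weight on its edges. For a circle packing metric $r:V\to(0,\infty)$ give each edge $ij$ the length $l_{ij}=\sqrt{r_i^2+r_j^2+2r_ir_j\cos\Phi_{ij}}$, let $\theta_i^{jk}$ be the angle at $i$ of the Euclidean triangle with side lengths $l_{ij},l_{jk},l_{ik}$ for $\{ijk\}\in F$, and set $K_i=2\pi-\sum_{\{ijk\}\in F}\theta_i^{jk}$. For $\alpha\in\mathbb R$, the $\alpha$-curvature of $r$ is $R_{\alpha,i}=K_i/r_i^{\alpha}$; put $s_\alpha=2\pi\chi(M)/\sum_{i=1}^N r_i^{\alpha}$. The $\alpha$-flow is the system $$\frac{du_i}{dt}=s_\alpha r_i^\alpha-K_i,\qquad u_i=\ln r_i,\quad i\in V.$$ Suppose $\alpha\chi(M)\le 0$. Then for every initial circle packing metric $r(0)$ the $\alpha$-flow has a solution $r(t)$, $t\in[0,\infty)$, and for every such solution: (1) $r(t)$ converges to a circle packing metric as $t\to+\infty$ if and only if there exists a circle packing metric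 of constant $\alpha$-curvature on $(M,\mathcal T,\Phi)$; (2) if $r(t)$ converges, then there is exactly one circle packing metric $r^*$ of constant $\alpha$-curvature with $\prod_i r^*_i=\prod_i r_i(0)$, and $r(t)$ converges to it exponentially fast: there are constants $C$ and $c>0$ with $|r_i(t)-r_i^*|\le Ce^{-ct}$ for all $t\ge0$ and $i\in V$. -/

import Mathlib

open scoped BigOperators Topology

namespace CirclePacking

variable {V : Type*}

/-- The length `l_ij = √(r_i² + r_j² + 2 r_i r_j cos Φ_ij)` of the edge `ij`. -/
noncomputable def edgeLength (Φ : Sym2 V → ℝ) (r : V → ℝ) (i j : V) : ℝ :=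
  Real.sqrt (r i ^ 2 + r j ^ 2 + 2 * r i * r j * Real.cos (Φ s(i, j)))

theorem edgeLength_comm (Φ : Sym2 V → ℝ) (r : V → ℝ) (i j : V) :
    edgeLength Φ r i j = edgeLength Φ r j i := by
  unfold edgeLength
  rw [Sym2.eq_swap]
  congr 1
  ring

/-- The inner angle at `i` of the Euclidean triangle `ijk` with the above edge lengths (by the law
of cosines), as a function of the vertex `i` and the opposite edge `jk`. -/
noncomputable def innerAngle (Φ : Sym2 V → ℝ) (r : V → ℝ) (i : V) : Sym2 V → ℝ :=
  Sym2.lift ⟨fun j k => Real.arccos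
      ((edgeLength Φ r i j ^ 2 + edgeLength Φ r i k ^ 2 - edgeLength Φ r j k ^ 2)
        / (2 * edgeLength Φ r i j * edgeLength Φ r i k)), fun j k => by
    simp only [edgeLength_comm Φ r k j]
    congr 1
    ring⟩

variable [Fintype V] [DecidableEq V]

/-- The 1-skeleton of a simplicial complex on `V`: the graph of its edges `i ∼ j`. -/
def skeleton (T : AbstractSimplicialComplex V) : SimpleGraph V where
  Adj i j := i ≠ j ∧ ({i, j} : Finset V) ∈ T
  symm := ⟨fun i j h => ⟨h.1.symm, by rw [Finset.pair_comm]; exact h.2⟩⟩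
  loopless := ⟨fun _ h => h.1 rfl⟩

/-- The link of the vertex `i`, as a graph: `j` and `k` are joined when `{i, j, k}` is a
(nondegenerate) triangle of the complex. Its edges correspond to the triangles containing `i`. -/
def linkGraph (T : AbstractSimplicialComplex V) (i : V) : SimpleGraph V where
  Adj j k := i ≠ j ∧ i ≠ k ∧ j ≠ k ∧ ({i, j, k} : Finset V) ∈ T
  symm := ⟨fun j k h => ⟨h.2.1, h.1, h.2.2.1.symm, by rw [Finset.pair_comm]; exact h.2.2.2⟩⟩
  loopless := ⟨fun _ h => h.2.2.1 rfl⟩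

/-- The finite simplicial complex `T`, with vertex set `V`, triangulates a connected closed
surface: it is at most two-dimensional, it is connected, and the link of every vertex is a cycle,
i.e. a connected graph (on the neighbours of the vertex) in which every vertex has degree two. -/
structure IsClosedSurface (T : AbstractSimplicialComplex V) : Prop where
  card_le_three : ∀ s ∈ T, s.card ≤ 3
  connected : (skeleton T).Connected
  link_connected : ∀ i, ((linkGraph T i).induce {j | (skeleton T).Adj i j}).Connected
  link_degree : ∀ i j, (skeleton T).Adj i j → ((linkGraph T i).neighborSet j).ncard = 2

/-- The Euler characteristic `|V| - |E| + |F|` of a two-dimensional complex. -/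
noncomputable def eulerChar (T : AbstractSimplicialComplex V) : ℤ :=
  (Fintype.card V : ℤ) - ({s : Finset V | s ∈ T ∧ s.card = 2}.ncard : ℤ)
    + ({s : Finset V | s ∈ T ∧ s.card = 3}.ncard : ℤ)

/-- `Φ` is a weight on the edges, with values in `[0, π/2]`. (Values of `Φ` at pairs that are not
edges are never used.) -/
def IsWeight (T : AbstractSimplicialComplex V) (Φ : Sym2 V → ℝ) : Prop :=
  ∀ e ∈ (skeleton T).edgeSet, Φ e ∈ Set.Icc 0 (Real.pi / 2)

/-- Circle packing metrics: positive functions on the vertices. -/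
def IsMetric (r : V → ℝ) : Prop := ∀ i, 0 < r i

open Classical in
/-- The classical discrete Gauss curvature `K_i = 2π - ∑ θ_i^{jk}`, the sum being over all
triangles `ijk` at `i`. -/
noncomputable def gaussCurvature (T : AbstractSimplicialComplex V) (Φ : Sym2 V → ℝ)
    (r : V → ℝ) (i : V) : ℝ :=
  2 * Real.pi - ∑ e ∈ (linkGraph T i).edgeFinset, innerAngle Φ r i e

/-- The `α`-curvature `R_{α,i} = K_i / r_i^α`. -/
noncomputable def alphaCurvature (T : AbstractSimplicialComplex V) (Φ : Sym2 V → ℝ) (α : ℝ)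
    (r : V → ℝ) (i : V) : ℝ :=
  gaussCurvature T Φ r i / r i ^ α

/-- `r` is a circle packing metric of constant `α`-curvature. -/
def IsConstantCurvature (T : AbstractSimplicialComplex V) (Φ : Sym2 V → ℝ) (α : ℝ)
    (r : V → ℝ) : Prop :=
  IsMetric r ∧ ∃ c : ℝ, ∀ i, alphaCurvature T Φ α r i = c

/-- `s_α = 2π χ(M) / ∑ r_i^α`. -/
noncomputable def sAlpha (T : AbstractSimplicialComplex V) (α : ℝ) (r : V → ℝ) : ℝ :=
  2 * Real.pi * (eulerChar T : ℝ) / ∑ i, r i ^ α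

/-- `r` is a solution on `[0, ∞)` of the `α`-flow `du_i/dt = s_α r_i^α - K_i`, `u_i = log r_i`. -/
def IsAlphaFlow (T : AbstractSimplicialComplex V) (Φ : Sym2 V → ℝ) (α : ℝ)
    (r : ℝ → V → ℝ) : Prop :=
  ∀ t : ℝ, 0 ≤ t → IsMetric (r t) ∧
    ∀ i, HasDerivWithinAt (fun τ => Real.log (r τ i))
      (sAlpha T α (r t) * r t i ^ α - gaussCurvature T Φ (r t) i) (Set.Ici 0) t

/-- `r(t)` converges, as `t → ∞`, to a circle packing metric. -/
def FlowConverges (r : ℝ → V → ℝ) : Prop :=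
  ∃ r' : V → ℝ, IsMetric r' ∧ Filter.Tendsto r Filter.atTop (𝓝 r')

/-- `r(t)` converges to `r'` exponentially fast as `t → ∞`. -/
def ConvergesExponentially (r : ℝ → V → ℝ) (r' : V → ℝ) : Prop :=
  ∃ C c : ℝ, 0 < c ∧ ∀ t : ℝ, 0 ≤ t → ∀ i, |r t i - r' i| ≤ C * Real.exp (-(c * t))

end CirclePacking

/-! In the logarithmic radii `u` the flow is the autonomous system `u' = X(u)`, with `X` the field
`flowField`, whose target term is `2πχ` times the softmax of `αu`. The derivative of a triangle's
angle involves only differences of the logarithmic variations, with a nonnegative coefficient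
(conductance) on each edge, symmetric in its endpoints. Summation by parts therefore turns the
derivative of the curvature into a Dirichlet energy (`hasDerivAt_sum_gaussCurvature`). At most one
conductance of a triangle vanishes and the surface is connected, so only constants have zero energy;
compactness makes the curvature strongly monotone on compact convex sets, along vectors of sum zero
(`exists_gaussCurvature_strongMono`). Softmax is monotone, so for `αχ ≤ 0` the target term only
helps, and `X` is strongly decreasing there (`exists_flowField_strongMono`).

The field `X` is `C¹` and bounded, hence has global solutions. By Gauss–Bonnet its components sum to
zero, so the product of the radii is conserved, and its zeros are exactly the metrics of constant
`α`-curvature. Scale invariance moves a zero to any prescribed product. Given a zero with the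
product of the trajectory, the squared distance to it in `u` does not increase; this confines the
trajectory to a compact ball, where strong monotonicity yields exponential decay
(`IsAlphaFlow.convergesExponentially`). Conversely, the limit of a convergent trajectory is a zero
of `X`. Uniqueness is strong monotonicity applied to two zeros. -/

namespace CirclePacking

/-! ### Angles of the triangle of three circles and their variation. -/

/-- Sixteen times the squared area of a triangle with squared side lengths `a`, `b`, `c`. -/
noncomputable def heron (a b c : ℝ) : ℝ :=
  4 * b * c - (b + c - a) ^ 2

/-- The squared distance of the centres of circles of radii `x`, `y` meeting at an angle of
cosine `γ`. -/
noncomputable def sqLen (x y γ : ℝ) : ℝ := x ^ 2 + y ^ 2 + 2 * x * y * γ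

/-- The derivative of the angle at the centre of the circle `x` with respect to `log y`, for the
triangle of three circles of radii `x`, `y`, `z`. -/
noncomputable def conductance (x y z α β γ : ℝ) : ℝ :=
  2 * x * y * (x * y * (1 - γ ^ 2) + x * z * (α + β * γ) + y * z * (β + α * γ)) /
    (sqLen x y γ * √(heron (sqLen y z α) (sqLen x z β) (sqLen x y γ)))

theorem sqLen_comm (x y γ : ℝ) : sqLen x y γ = sqLen y x γ := by
  unfold sqLen; ring

theorem heron_swap_right (a b c : ℝ) : heron a b c = heron a c b := by
  unfold heron; ring

theorem heron_swap_left (a b c : ℝ) : heron a b c = heron b a c := by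
  unfold heron; ring

theorem conductance_comm (x y z α β γ : ℝ) :
    conductance x y z α β γ = conductance y x z β α γ := by
  unfold conductance
  rw [sqLen_comm x y, heron_swap_left]
  congr 1
  ring

theorem sqLen_pos {x y γ : ℝ} (hx : 0 < x) (hy : 0 < y) (hγ : 0 ≤ γ) : 0 < sqLen x y γ := by
  unfold sqLen; positivity

/-- Expanding gives a sum of terms that are nonnegative for cosines in `[0, 1]`: acute weights
always produce nondegenerate triangles. Strict positivity comes from `(yz)²(1 - α²)` if `α = 0`, and
from the term containing `α` otherwise. -/
theorem heron_sqLen_pos {x y z α β γ : ℝ} (hx : 0 < x) (hy : 0 < y) (hz : 0 < z)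
    (hα : 0 ≤ α) (hβ : 0 ≤ β) (hγ : 0 ≤ γ) (hα1 : α ≤ 1) (hβ1 : β ≤ 1) (hγ1 : γ ≤ 1) :
    0 < heron (sqLen y z α) (sqLen x z β) (sqLen x y γ) := by
  have key : heron (sqLen y z α) (sqLen x z β) (sqLen x y γ) =
      4 * ((x * y) ^ 2 * (1 - γ ^ 2) + (x * z) ^ 2 * (1 - β ^ 2) + (y * z) ^ 2 * (1 - α ^ 2)
        + 2 * x ^ 2 * y * z * (α + β * γ) + 2 * x * y ^ 2 * z * (β + α * γ)
        + 2 * x * y * z ^ 2 * (γ + α * β)) := by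
    unfold heron sqLen; ring
  have ha : 0 ≤ 1 - α ^ 2 := by nlinarith
  have hb : 0 ≤ 1 - β ^ 2 := by nlinarith
  have hc : 0 ≤ 1 - γ ^ 2 := by nlinarith
  rw [key]
  rcases hα.eq_or_lt with rfl | h1
  · have : 0 < (y * z) ^ 2 * (1 - (0 : ℝ) ^ 2) := by norm_num; positivity
    positivity
  · positivity

theorem conductance_nonneg {x y z α β γ : ℝ} (hx : 0 < x) (hy : 0 < y) (hz : 0 < z)
    (hα : 0 ≤ α) (hβ : 0 ≤ β) (hγ : 0 ≤ γ) (hγ1 : γ ≤ 1) :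
    0 ≤ conductance x y z α β γ := by
  have hc : 0 ≤ 1 - γ ^ 2 := by nlinarith
  have := sqLen_pos hx hy hγ
  unfold conductance
  positivity

theorem conductance_pos {x y z α β γ : ℝ} (hx : 0 < x) (hy : 0 < y) (hz : 0 < z)
    (hα : 0 ≤ α) (hβ : 0 ≤ β) (hγ : 0 ≤ γ) (hα1 : α ≤ 1) (hβ1 : β ≤ 1) (hγ1 : γ ≤ 1)
    (h : γ < 1 ∨ 0 < α ∨ 0 < β) :
    0 < conductance x y z α β γ := by
  have hc : 0 ≤ 1 - γ ^ 2 := by nlinarith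
  have := sqLen_pos hx hy hγ
  have := heron_sqLen_pos hx hy hz hα hβ hγ hα1 hβ1 hγ1
  unfold conductance
  apply div_pos _ (by positivity)
  rcases h with h | h | h
  · have : 0 < 1 - γ ^ 2 := by nlinarith
    positivity
  · positivity
  · positivity

/-- At most one of the three conductances of a triangle vanishes. -/
theorem conductance_pos_or {x y z α β γ : ℝ} (hx : 0 < x) (hy : 0 < y) (hz : 0 < z)
    (hα : 0 ≤ α) (hβ : 0 ≤ β) (hγ : 0 ≤ γ) (hα1 : α ≤ 1) (hβ1 : β ≤ 1) (hγ1 : γ ≤ 1) :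
    0 < conductance x y z α β γ ∨
      (0 < conductance x z y α γ β ∧ 0 < conductance y z x β γ α) := by
  -- A conductance can vanish only if its own edge is a tangency (`γ = 1`) and the other two cosines
  -- are zero, which makes those two edges safe.
  by_cases h : γ < 1 ∨ 0 < α ∨ 0 < β
  · exact Or.inl (conductance_pos hx hy hz hα hβ hγ hα1 hβ1 hγ1 h)
  · push Not at h
    right
    constructor
    · exact conductance_pos hx hz hy hα hγ hβ hα1 hγ1 hβ1 (Or.inl (by linarith))
    · exact conductance_pos hy hz hx hβ hγ hα hβ1 hγ1 hα1 (Or.inl (by linarith))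

/-- The angle opposite to the first side of a triangle with squared side lengths `a`, `b`, `c`. -/
noncomputable def sideAngle (a b c : ℝ) : ℝ :=
  Real.arccos ((c + b - a) / (2 * √c * √b))

theorem sideAngle_swap (a b c : ℝ) : sideAngle a b c = sideAngle a c b := by
  unfold sideAngle
  congr 1
  ring

theorem cos_sideAngle_arg_sq {a b c : ℝ} (hb : 0 < b) (hc : 0 < c) :
    1 - ((c + b - a) / (2 * √c * √b)) ^ 2 = heron a b c / (4 * b * c) := by
  rw [div_pow, mul_pow, mul_pow, Real.sq_sqrt hb.le, Real.sq_sqrt hc.le]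
  unfold heron
  field_simp
  ring

/-- The quotient is the cotangent of the angle. In this form nothing is singular while the area is
positive, so it serves for derivatives and smoothness in place of the arccosine. -/
theorem sideAngle_eq_arctan {a b c : ℝ} (hb : 0 < b) (hc : 0 < c) (h : 0 < heron a b c) :
    sideAngle a b c = Real.pi / 2 - Real.arctan ((b + c - a) / √(heron a b c)) := by
  have h1 := cos_sideAngle_arg_sq (a := a) hb hc
  have hpos : 0 < heron a b c / (4 * b * c) := by positivity
  have hmem : (c + b - a) / (2 * √c * √b) ∈ Set.Ioo (-1 : ℝ) 1 :=
    abs_lt.mp ((sq_lt_one_iff_abs_lt_one _).mp (by linarith))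
  unfold sideAngle
  rw [Real.arccos_eq_pi_div_two_sub_arcsin, Real.arcsin_eq_arctan hmem, h1]
  congr 2
  rw [Real.sqrt_div h.le, mul_assoc 4 b c, Real.sqrt_mul (by norm_num), Real.sqrt_mul hb.le,
    show (4 : ℝ) = 2 ^ 2 by norm_num, Real.sqrt_sq (by norm_num)]
  have := Real.sqrt_pos.mpr hb
  have := Real.sqrt_pos.mpr hc
  have := Real.sqrt_pos.mpr h
  field_simp
  ring

theorem cos_sideAngle {a b c : ℝ} (hb : 0 < b) (hc : 0 < c) (h : 0 < heron a b c) :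
    Real.cos (sideAngle a b c) = (c + b - a) / (2 * √c * √b) := by
  have h1 := cos_sideAngle_arg_sq (a := a) hb hc
  have hpos : 0 < heron a b c / (4 * b * c) := by positivity
  have hmem := abs_lt.mp ((sq_lt_one_iff_abs_lt_one _).mp
    (show ((c + b - a) / (2 * √c * √b)) ^ 2 < 1 by linarith))
  exact Real.cos_arccos hmem.1.le hmem.2.le

theorem sin_sideAngle {a b c : ℝ} (hb : 0 < b) (hc : 0 < c) (h : 0 < heron a b c) :
    Real.sin (sideAngle a b c) = √(heron a b c) / (2 * √c * √b) := by
  unfold sideAngle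
  rw [Real.sin_arccos, cos_sideAngle_arg_sq hb hc, Real.sqrt_div h.le, mul_assoc 4 b c,
    Real.sqrt_mul (by norm_num), Real.sqrt_mul hb.le, show (4 : ℝ) = 2 ^ 2 by norm_num,
    Real.sqrt_sq (by norm_num)]
  congr 1
  ring

theorem sideAngle_pos {a b c : ℝ} (hb : 0 < b) (hc : 0 < c) (h : 0 < heron a b c) :
    0 < sideAngle a b c := by
  have h2 : 0 < Real.sin (sideAngle a b c) := by
    rw [sin_sideAngle hb hc h]; positivity
  by_contra hn
  have : sideAngle a b c = 0 := le_antisymm (not_lt.mp hn) (Real.arccos_nonneg _)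
  simp [this] at h2

theorem sideAngle_add_add {a b c : ℝ} (ha : 0 < a) (hb : 0 < b) (hc : 0 < c)
    (h : 0 < heron a b c) :
    sideAngle a b c + sideAngle b a c + sideAngle c a b = Real.pi := by
  have h' : 0 < heron b a c := by rwa [heron_swap_left]
  have h'' : 0 < heron c a b := by
    rwa [heron_swap_left, heron_swap_right, heron_swap_left] at h ⊢
  have e' : heron b a c = heron a b c := heron_swap_left _ _ _
  have sa := Real.sqrt_pos.mpr ha
  have sb := Real.sqrt_pos.mpr hb
  have sc := Real.sqrt_pos.mpr hc
  have qa := Real.sq_sqrt ha.le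
  have qb := Real.sq_sqrt hb.le
  have qc := Real.sq_sqrt hc.le
  have sQ := Real.sqrt_pos.mpr h
  have qQ := Real.sq_sqrt h.le
  -- The law of cosines determines the sum of two angles only up to sign and period; positivity of
  -- its sine then puts the sum in `[0, π]`, where cosine is injective.
  have hcos : Real.cos (sideAngle a b c + sideAngle b a c) =
      Real.cos (Real.pi - sideAngle c a b) := by
    rw [Real.cos_add, Real.cos_pi_sub, cos_sideAngle hb hc h, cos_sideAngle ha hc h',
      cos_sideAngle ha hb h'', sin_sideAngle hb hc h, sin_sideAngle ha hc h', e']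
    have : (c + b - a) * (c + a - b) - heron a b c = - (2 * c * (b + a - c)) := by
      unfold heron; ring
    field_simp
    rw [qQ, qc, this]
  have hsin : 0 < Real.sin (sideAngle a b c + sideAngle b a c) := by
    rw [Real.sin_add, cos_sideAngle hb hc h, cos_sideAngle ha hc h',
      sin_sideAngle hb hc h, sin_sideAngle ha hc h', e']
    have : √(heron a b c) / (2 * √c * √b) * ((c + a - b) / (2 * √c * √a)) +
        (c + b - a) / (2 * √c * √b) * (√(heron a b c) / (2 * √c * √a)) =
        √(heron a b c) * (2 * c) / (4 * √c ^ 2 * √a * √b) := by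
      field_simp; ring
    rw [this]
    positivity
  have p1 := sideAngle_pos hb hc h
  have p2 := sideAngle_pos ha hc h'
  have l1 : sideAngle a b c ≤ Real.pi := Real.arccos_le_pi _
  have l2 : sideAngle b a c ≤ Real.pi := Real.arccos_le_pi _
  have lt : sideAngle a b c + sideAngle b a c ≤ Real.pi := by
    by_contra hn
    have := Real.sin_nonpos_of_nonpos_of_neg_pi_le
      (x := sideAngle a b c + sideAngle b a c - 2 * Real.pi) (by linarith) (by linarith)
    rw [Real.sin_sub_two_pi] at this
    linarith
  have p3 : 0 ≤ sideAngle c a b := Real.arccos_nonneg _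
  have l3 : sideAngle c a b ≤ Real.pi := Real.arccos_le_pi _
  have := Real.injOn_cos ⟨by linarith, lt⟩ ⟨by linarith, by linarith⟩ hcos
  linarith

theorem hasDerivAt_sideAngle {a b c : ℝ → ℝ} {a' b' c' t : ℝ} (ha : HasDerivAt a a' t)
    (hb : HasDerivAt b b' t) (hc : HasDerivAt c c' t) (hb0 : 0 < b t) (hc0 : 0 < c t)
    (h : 0 < heron (a t) (b t) (c t)) :
    HasDerivAt (fun s => sideAngle (a s) (b s) (c s))
      ((a' - (a t + b t - c t) / (2 * b t) * b' - (a t + c t - b t) / (2 * c t) * c') /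
        √(heron (a t) (b t) (c t))) t := by
  have hQ : HasDerivAt (fun s => heron (a s) (b s) (c s))
      (4 * b' * c t + 4 * b t * c' - 2 * (b t + c t - a t) * (b' + c' - a')) t := by
    unfold heron
    convert! ((hb.const_mul 4).mul hc).sub (((hb.add hc).sub ha).pow 2) using 1
    simp
  have hp := (hb.add hc).sub ha
  have hmain := ((hp.div (hQ.sqrt h.ne') (Real.sqrt_pos.mpr h).ne').arctan).const_sub (Real.pi / 2)
  have hev : (fun s => sideAngle (a s) (b s) (c s)) =ᶠ[𝓝 t]
      fun s => Real.pi / 2 - Real.arctan ((b s + c s - a s) / √(heron (a s) (b s) (c s))) := by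
    filter_upwards [hb.continuousAt.eventually_const_lt hb0,
      hc.continuousAt.eventually_const_lt hc0, hQ.continuousAt.eventually_const_lt h]
      with s h1 h2 h3
    exact sideAngle_eq_arctan h1 h2 h3
  refine (HasDerivAt.congr_of_eventuallyEq ?_ hev)
  convert! hmain using 1
  have sQ := Real.sqrt_pos.mpr h
  have qQ := Real.sq_sqrt h.le
  simp only [Pi.add_apply, Pi.sub_apply, Pi.div_apply]
  set S := √(heron (a t) (b t) (c t))
  -- This is `1 + cot² = 1 / sin²`; it cancels the denominator produced by the arctangent and leaves
  -- a single factor of the area.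
  have e1 : 1 + ((b t + c t - a t) / S) ^ 2 = 4 * b t * c t / S ^ 2 := by
    have : S ^ 2 = 4 * b t * c t - (b t + c t - a t) ^ 2 := qQ
    field_simp
    linarith
  rw [e1]
  field_simp
  rw [qQ]
  unfold heron
  ring

/-- Here `u`, `v`, `w` are logarithmic derivatives of the radii. Only `v - u` and `w - u` enter
because angles do not change under scaling. -/
theorem hasDerivAt_sideAngle_sqLen {x y z : ℝ → ℝ} {u v w α β γ t : ℝ}
    (hx : HasDerivAt x (x t * u) t) (hy : HasDerivAt y (y t * v) t) (hz : HasDerivAt z (z t * w) t)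
    (hx0 : 0 < x t) (hy0 : 0 < y t) (hz0 : 0 < z t)
    (hα : 0 ≤ α) (hβ : 0 ≤ β) (hγ : 0 ≤ γ) (hα1 : α ≤ 1) (hβ1 : β ≤ 1) (hγ1 : γ ≤ 1) :
    HasDerivAt (fun s => sideAngle (sqLen (y s) (z s) α) (sqLen (x s) (z s) β)
        (sqLen (x s) (y s) γ))
      (conductance (x t) (y t) (z t) α β γ * (v - u) +
        conductance (x t) (z t) (y t) α γ β * (w - u)) t := by
  have hlen : ∀ {p q : ℝ → ℝ} {g h κ : ℝ}, HasDerivAt p (p t * g) t → HasDerivAt q (q t * h) t →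
      HasDerivAt (fun s => sqLen (p s) (q s) κ)
        (2 * p t ^ 2 * g + 2 * q t ^ 2 * h + 2 * p t * q t * κ * (g + h)) t := by
    intro p q g h κ hp hq
    unfold sqLen
    convert! ((hp.pow 2).add (hq.pow 2)).add (((hp.const_mul 2).mul hq).mul_const κ) using 1
    simp
    ring
  have hb0 := sqLen_pos hx0 hz0 hβ
  have hc0 := sqLen_pos hx0 hy0 hγ
  have hh := heron_sqLen_pos hx0 hy0 hz0 hα hβ hγ hα1 hβ1 hγ1
  convert! hasDerivAt_sideAngle (hlen (κ := α) hy hz) (hlen (κ := β) hx hz) (hlen (κ := γ) hx hy)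
    hb0 hc0 hh using 1
  unfold conductance
  rw [sqLen_comm (z t) (y t), heron_swap_right (sqLen (y t) (z t) α) (sqLen (x t) (y t) γ)]
  have sQ := Real.sqrt_pos.mpr hh
  set S := √(heron (sqLen (y t) (z t) α) (sqLen (x t) (z t) β) (sqLen (x t) (y t) γ))
  field_simp
  unfold sqLen
  ring

end CirclePacking

/-! ### Sums over ordered triangles and the Euler characteristic. -/

namespace CirclePacking

variable {V : Type*} [DecidableEq V]

theorem linkGraph_adj_rotate {T : AbstractSimplicialComplex V} {i j k : V}
    (h : (linkGraph T i).Adj j k) : (linkGraph T j).Adj k i := by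
  obtain ⟨hij, hik, hjk, hT⟩ := h
  refine ⟨hjk, hij.symm, hik.symm, ?_⟩
  convert hT using 1
  ext; simp; tauto

theorem linkGraph_adj_rotate_iff (T : AbstractSimplicialComplex V) (i j k : V) :
    (linkGraph T i).Adj j k ↔ (linkGraph T j).Adj k i :=
  ⟨linkGraph_adj_rotate, fun h => linkGraph_adj_rotate (linkGraph_adj_rotate h)⟩

theorem skeleton_adj_of_linkGraph_adj {T : AbstractSimplicialComplex V} {i j k : V}
    (h : (linkGraph T i).Adj j k) : (skeleton T).Adj i j := by
  obtain ⟨hij, hik, hjk, hT⟩ := h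
  refine ⟨hij, (T.isRelLowerSet_faces hT).2 ?_ (by simp)⟩
  intro x; simp; tauto

variable [Fintype V]

open Classical in
/-- The sum of `F i j k` over all ordered triangles `(i, j, k)` of the complex. -/
noncomputable def triangleSum (T : AbstractSimplicialComplex V) (F : V → V → V → ℝ) : ℝ :=
  ∑ i, ∑ j, ∑ k, if (linkGraph T i).Adj j k then F i j k else 0

theorem triangleSum_congr {T : AbstractSimplicialComplex V} {F G : V → V → V → ℝ}
    (h : ∀ i j k, (linkGraph T i).Adj j k → F i j k = G i j k) :
    triangleSum T F = triangleSum T G := by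
  unfold triangleSum
  refine Finset.sum_congr rfl fun i _ => Finset.sum_congr rfl fun j _ =>
    Finset.sum_congr rfl fun k _ => ?_
  split_ifs with hijk
  · exact h i j k hijk
  · rfl

theorem triangleSum_add (T : AbstractSimplicialComplex V) (F G : V → V → V → ℝ) :
    triangleSum T (fun i j k => F i j k + G i j k) = triangleSum T F + triangleSum T G := by
  unfold triangleSum
  simp only [← Finset.sum_add_distrib]
  refine Finset.sum_congr rfl fun i _ => Finset.sum_congr rfl fun j _ =>
    Finset.sum_congr rfl fun k _ => ?_
  split_ifs <;> simp

theorem triangleSum_const_mul (T : AbstractSimplicialComplex V) (c : ℝ) (F : V → V → V → ℝ) :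
    triangleSum T (fun i j k => c * F i j k) = c * triangleSum T F := by
  unfold triangleSum
  simp only [Finset.mul_sum]
  refine Finset.sum_congr rfl fun i _ => Finset.sum_congr rfl fun j _ =>
    Finset.sum_congr rfl fun k _ => ?_
  split_ifs <;> simp

/-- Being a triangle does not depend on the order of its vertices. Together with `triangleSum_swap`
this gives all relabellings needed for Gauss–Bonnet and for summation by parts. -/
theorem triangleSum_rotate (T : AbstractSimplicialComplex V) (F : V → V → V → ℝ) :
    triangleSum T (fun i j k => F j k i) = triangleSum T F := by
  classical
  unfold triangleSum
  rw [Finset.sum_comm]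
  refine Finset.sum_congr rfl fun i _ => ?_
  rw [Finset.sum_comm]
  refine Finset.sum_congr rfl fun j _ => Finset.sum_congr rfl fun k _ => ?_
  exact if_congr (linkGraph_adj_rotate_iff T k i j) rfl rfl

theorem triangleSum_swap (T : AbstractSimplicialComplex V) (F : V → V → V → ℝ) :
    triangleSum T (fun i j k => F i k j) = triangleSum T F := by
  classical
  unfold triangleSum
  refine Finset.sum_congr rfl fun i _ => ?_
  rw [Finset.sum_comm]
  refine Finset.sum_congr rfl fun j _ => Finset.sum_congr rfl fun k _ => ?_
  exact if_congr ((linkGraph T i).adj_comm k j) rfl rfl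

theorem triangleSum_nonneg {T : AbstractSimplicialComplex V} {F : V → V → V → ℝ}
    (h : ∀ i j k, (linkGraph T i).Adj j k → 0 ≤ F i j k) : 0 ≤ triangleSum T F := by
  unfold triangleSum
  refine Finset.sum_nonneg fun i _ => Finset.sum_nonneg fun j _ =>
    Finset.sum_nonneg fun k _ => ?_
  split_ifs with hijk
  · exact h i j k hijk
  · rfl

theorem le_triangleSum {T : AbstractSimplicialComplex V} {F : V → V → V → ℝ}
    (h : ∀ i j k, (linkGraph T i).Adj j k → 0 ≤ F i j k) {i j k : V}
    (hijk : (linkGraph T i).Adj j k) : F i j k ≤ triangleSum T F := by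
  classical
  have h0 : ∀ i j k, 0 ≤ if (linkGraph T i).Adj j k then F i j k else 0 := by
    intro i j k
    split_ifs with hh
    · exact h i j k hh
    · rfl
  unfold triangleSum
  calc F i j k = if (linkGraph T i).Adj j k then F i j k else 0 := (if_pos hijk).symm
    _ ≤ ∑ k, if (linkGraph T i).Adj j k then F i j k else 0 :=
        Finset.single_le_sum (f := fun k => if (linkGraph T i).Adj j k then F i j k else 0)
          (fun k _ => h0 i j k) (Finset.mem_univ k)
    _ ≤ ∑ j, ∑ k, if (linkGraph T i).Adj j k then F i j k else 0 :=
        Finset.single_le_sum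
          (f := fun j => ∑ k, if (linkGraph T i).Adj j k then F i j k else 0)
          (fun j _ => Finset.sum_nonneg fun k _ => h0 i j k) (Finset.mem_univ j)
    _ ≤ _ := by
        convert Finset.single_le_sum
          (f := fun i => ∑ j, ∑ k, if (linkGraph T i).Adj j k then F i j k else 0)
          (fun i _ => Finset.sum_nonneg fun j _ => Finset.sum_nonneg fun k _ => h0 i j k)
          (Finset.mem_univ i)

/-- Each edge underlies exactly two darts. -/
theorem two_mul_sum_edgeFinset (G : SimpleGraph V) [DecidableRel G.Adj] (f : Sym2 V → ℝ) :
    2 * ∑ e ∈ G.edgeFinset, f e = ∑ j, ∑ k, if G.Adj j k then f s(j, k) else 0 := by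
  have h1 : ∑ d : G.Dart, f d.edge = 2 * ∑ e ∈ G.edgeFinset, f e := by
    rw [← Finset.sum_fiberwise_of_maps_to (s := Finset.univ) (t := G.edgeFinset)
      (g := fun d : G.Dart => d.edge) (fun d _ => by simp), Finset.mul_sum]
    refine Finset.sum_congr rfl fun e he => ?_
    rw [Finset.sum_congr rfl (g := fun _ => f e)
      (fun d hd => by rw [(Finset.mem_filter.1 hd).2]), Finset.sum_const,
      G.dart_edge_fiber_card e (by simpa using he)]
    simp
  rw [← h1, ← Fintype.sum_prod_type' (f := fun j k => if G.Adj j k then f s(j, k) else 0),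
    ← Finset.sum_filter]
  refine Finset.sum_bij' (fun d _ => (d.fst, d.snd))
    (fun p h => ⟨p, (Finset.mem_filter.1 h).2⟩) ?_ ?_ ?_ ?_ ?_ <;> simp
  intro d
  rfl

/-- The weight `h` serves two ends: `h = 1` leads to Gauss–Bonnet, and `h` equal to the direction of
variation leads to the Dirichlet energy. -/
theorem sum_gaussCurvature_mul (T : AbstractSimplicialComplex V) (Φ : Sym2 V → ℝ) (r h : V → ℝ) :
    ∑ i, gaussCurvature T Φ r i * h i = 2 * Real.pi * ∑ i, h i -
      2⁻¹ * triangleSum T (fun i j k => innerAngle Φ r i s(j, k) * h i) := by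
  classical
  unfold triangleSum
  rw [Finset.mul_sum, Finset.mul_sum, ← Finset.sum_sub_distrib]
  refine Finset.sum_congr rfl fun i _ => ?_
  have := two_mul_sum_edgeFinset (linkGraph T i) (innerAngle Φ r i)
  have h2 : ∑ j, ∑ k, (if (linkGraph T i).Adj j k then innerAngle Φ r i s(j, k) * h i else 0) =
      (∑ j, ∑ k, if (linkGraph T i).Adj j k then innerAngle Φ r i s(j, k) else 0) * h i := by
    simp only [Finset.sum_mul, ite_mul, zero_mul]
  rw [h2, ← this]
  unfold gaussCurvature
  have e : ∀ (I : Fintype (linkGraph T i).edgeSet),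
      ∑ e ∈ @SimpleGraph.edgeFinset V (linkGraph T i) I, innerAngle Φ r i e =
      ∑ e ∈ (linkGraph T i).edgeFinset, innerAngle Φ r i e := by
    intro I; congr!
  rw [e]
  ring

theorem ncard_edges (T : AbstractSimplicialComplex V) [DecidableRel (skeleton T).Adj] :
    2 * {s : Finset V | s ∈ T ∧ s.card = 2}.ncard =
      (Finset.univ.filter fun p : V × V => (skeleton T).Adj p.1 p.2).card := by
  classical
  rw [Set.ncard_eq_toFinset_card', Finset.card_eq_sum_card_fiberwise
    (f := fun p : V × V => ({p.1, p.2} : Finset V))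
    (t := {s : Finset V | s ∈ T ∧ s.card = 2}.toFinset), Finset.sum_const_nat (m := 2), mul_comm]
  · intro s hs
    rw [Set.mem_toFinset] at hs
    obtain ⟨hsT, hs2⟩ := hs
    obtain ⟨a, b, hab, rfl⟩ := Finset.card_eq_two.mp hs2
    have : (Finset.univ.filter fun p : V × V => (skeleton T).Adj p.1 p.2).filter
        (fun p => ({p.1, p.2} : Finset V) = {a, b}) = {(a, b), (b, a)} := by
      ext ⟨i, j⟩
      simp only [Finset.mem_filter, Finset.mem_univ, true_and, Finset.mem_insert,
        Finset.mem_singleton, Prod.mk.injEq]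
      constructor
      · rintro ⟨⟨hij, -⟩, he⟩
        have h1 : i ∈ ({a, b} : Finset V) := by rw [← he]; simp
        have h2 : j ∈ ({a, b} : Finset V) := by rw [← he]; simp
        simp only [Finset.mem_insert, Finset.mem_singleton] at h1 h2
        grind
      · rintro (⟨rfl, rfl⟩ | ⟨rfl, rfl⟩)
        · exact ⟨⟨hab, hsT⟩, rfl⟩
        · exact ⟨⟨hab.symm, by rwa [Finset.pair_comm]⟩, Finset.pair_comm _ _⟩
    rw [this, Finset.card_pair (by simp [hab])]
  · rintro ⟨i, j⟩ hp
    have hp : (skeleton T).Adj i j := by simpa using hp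
    rw [Set.coe_toFinset]
    exact ⟨hp.2, Finset.card_pair hp.1⟩

theorem ncard_triangles (T : AbstractSimplicialComplex V)
    [DecidablePred fun p : V × V × V => (linkGraph T p.1).Adj p.2.1 p.2.2] :
    6 * {s : Finset V | s ∈ T ∧ s.card = 3}.ncard =
      (Finset.univ.filter fun p : V × V × V => (linkGraph T p.1).Adj p.2.1 p.2.2).card := by
  classical
  rw [Set.ncard_eq_toFinset_card', Finset.card_eq_sum_card_fiberwise
    (f := fun p : V × V × V => ({p.1, p.2.1, p.2.2} : Finset V))
    (t := {s : Finset V | s ∈ T ∧ s.card = 3}.toFinset), Finset.sum_const_nat (m := 6), mul_comm]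
  · intro s hs
    rw [Set.mem_toFinset] at hs
    obtain ⟨hsT, hs3⟩ := hs
    obtain ⟨a, b, c, hab, hac, hbc, rfl⟩ := Finset.card_eq_three.mp hs3
    have h0 : (linkGraph T a).Adj b c := ⟨hab, hac, hbc, hsT⟩
    have : (Finset.univ.filter fun p : V × V × V => (linkGraph T p.1).Adj p.2.1 p.2.2).filter
        (fun p => ({p.1, p.2.1, p.2.2} : Finset V) = {a, b, c}) =
        {(a, b, c), (a, c, b), (b, a, c), (b, c, a), (c, a, b), (c, b, a)} := by
      ext ⟨i, j, k⟩
      simp only [Finset.mem_filter, Finset.mem_univ, true_and, Finset.mem_insert,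
        Finset.mem_singleton, Prod.mk.injEq]
      constructor
      · rintro ⟨⟨hij, hik, hjk, -⟩, he⟩
        have h1 : i ∈ ({a, b, c} : Finset V) := by rw [← he]; simp
        have h2 : j ∈ ({a, b, c} : Finset V) := by rw [← he]; simp
        have h3 : k ∈ ({a, b, c} : Finset V) := by rw [← he]; simp
        simp only [Finset.mem_insert, Finset.mem_singleton] at h1 h2 h3
        grind
      · have h1 := linkGraph_adj_rotate h0
        have h2 := linkGraph_adj_rotate h1
        rintro (⟨rfl, rfl, rfl⟩ | ⟨rfl, rfl, rfl⟩ | ⟨rfl, rfl, rfl⟩ | ⟨rfl, rfl, rfl⟩ |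
          ⟨rfl, rfl, rfl⟩ | ⟨rfl, rfl, rfl⟩)
        · exact ⟨h0, rfl⟩
        · exact ⟨h0.symm, by ext; simp; tauto⟩
        · exact ⟨h1.symm, by ext; simp; tauto⟩
        · exact ⟨h1, by ext; simp; tauto⟩
        · exact ⟨h2, by ext; simp; tauto⟩
        · exact ⟨h2.symm, by ext; simp; tauto⟩
    rw [this]
    simp [Finset.card_insert_of_notMem, hab, hac, hbc, hab.symm, hac.symm, hbc.symm]
  · rintro ⟨i, j, k⟩ hp
    have hp : (linkGraph T i).Adj j k := by simpa using hp
    rw [Set.coe_toFinset]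
    obtain ⟨hij, hik, hjk, hT⟩ := hp
    exact ⟨hT, Finset.card_eq_three.mpr ⟨i, j, k, hij, hik, hjk, rfl⟩⟩

theorem triangleSum_one_eq_faces (T : AbstractSimplicialComplex V) :
    triangleSum T (fun _ _ _ => 1) = 6 * ({s : Finset V | s ∈ T ∧ s.card = 3}.ncard : ℝ) := by
  classical
  have := ncard_triangles T
  rw [Finset.card_filter, Fintype.sum_prod_type] at this
  simp only [Fintype.sum_prod_type] at this
  unfold triangleSum
  beta_reduce
  exact_mod_cast this.symm

/-- Closedness enters here: each of the two orientations of an edge extends to exactly two ordered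
triangles, as links have degree two. -/
theorem triangleSum_one_eq_edges {T : AbstractSimplicialComplex V} (hT : IsClosedSurface T) :
    triangleSum T (fun _ _ _ => 1) = 4 * ({s : Finset V | s ∈ T ∧ s.card = 2}.ncard : ℝ) := by
  classical
  have := ncard_edges T
  rw [Finset.card_filter, Fintype.sum_prod_type] at this
  have h2 : ∀ i j, (∑ k, if (linkGraph T i).Adj j k then (1 : ℝ) else 0) =
      2 * if (skeleton T).Adj i j then 1 else 0 := by
    intro i j
    split_ifs with h
    · have := hT.link_degree i j h
      rw [Set.ncard_eq_toFinset_card'] at this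
      rw [← Finset.sum_filter, Finset.sum_const]
      have e : Finset.univ.filter (fun k => (linkGraph T i).Adj j k) =
          ((linkGraph T i).neighborSet j).toFinset := by
        ext; simp
      rw [e, this]
      simp
    · simp only [mul_zero]
      refine Finset.sum_eq_zero fun k _ => if_neg fun hk => h (skeleton_adj_of_linkGraph_adj hk)
  unfold triangleSum
  simp only [h2, ← Finset.mul_sum]
  have h3 : (2 : ℝ) * ({s : Finset V | s ∈ T ∧ s.card = 2}.ncard : ℝ) =
      ∑ i, ∑ j, if (skeleton T).Adj i j then 1 else 0 := by exact_mod_cast this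
  rw [← h3]
  ring

theorem eulerChar_eq {T : AbstractSimplicialComplex V} (hT : IsClosedSurface T) :
    (eulerChar T : ℝ) = Fintype.card V - triangleSum T (fun _ _ _ => 1) / 12 := by
  have h1 := triangleSum_one_eq_faces T
  have h2 := triangleSum_one_eq_edges hT
  unfold eulerChar
  push_cast
  linarith

end CirclePacking

/-! ### Gauss–Bonnet and the first variation of the curvature. -/

namespace CirclePacking

variable {V : Type*}

/-- The conductance of the edge `ij` in the triangle `ijk`. -/
noncomputable def edgeConductance (Φ : Sym2 V → ℝ) (r : V → ℝ) (i j k : V) : ℝ :=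
  conductance (r i) (r j) (r k) (Real.cos (Φ s(j, k))) (Real.cos (Φ s(i, k)))
    (Real.cos (Φ s(i, j)))

theorem edgeConductance_comm (Φ : Sym2 V → ℝ) (r : V → ℝ) (i j k : V) :
    edgeConductance Φ r i j k = edgeConductance Φ r j i k := by
  unfold edgeConductance
  rw [conductance_comm, Sym2.eq_swap (a := j) (b := i)]

/-- The metric with logarithmic radii `u`. -/
noncomputable def expMetric (u : V → ℝ) : V → ℝ := fun i => Real.exp (u i)

theorem isMetric_expMetric (u : V → ℝ) : IsMetric (expMetric u) := fun i => Real.exp_pos (u i)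

variable [DecidableEq V]

theorem IsWeight.cos_mem {T : AbstractSimplicialComplex V} {Φ : Sym2 V → ℝ} (hΦ : IsWeight T Φ)
    {i j : V} (h : (skeleton T).Adj i j) :
    0 ≤ Real.cos (Φ s(i, j)) ∧ Real.cos (Φ s(i, j)) ≤ 1 := by
  have := hΦ s(i, j) h
  exact ⟨Real.cos_nonneg_of_mem_Icc ⟨by linarith [this.1, Real.pi_pos], this.2⟩, Real.cos_le_one _⟩

/-- The three edges of a triangle are edges of the complex. -/
theorem skeleton_adj_of_triangle {T : AbstractSimplicialComplex V} {i j k : V}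
    (h : (linkGraph T i).Adj j k) :
    (skeleton T).Adj j k ∧ (skeleton T).Adj i k ∧ (skeleton T).Adj i j :=
  ⟨skeleton_adj_of_linkGraph_adj (linkGraph_adj_rotate h), skeleton_adj_of_linkGraph_adj h.symm,
    skeleton_adj_of_linkGraph_adj h⟩

theorem innerAngle_eq_sideAngle {T : AbstractSimplicialComplex V} {Φ : Sym2 V → ℝ}
    (hΦ : IsWeight T Φ) {r : V → ℝ} (hr : IsMetric r) {i j k : V}
    (h : (linkGraph T i).Adj j k) :
    innerAngle Φ r i s(j, k) = sideAngle (sqLen (r j) (r k) (Real.cos (Φ s(j, k))))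
      (sqLen (r i) (r k) (Real.cos (Φ s(i, k)))) (sqLen (r i) (r j) (Real.cos (Φ s(i, j)))) := by
  obtain ⟨hjk, hik, hij⟩ := skeleton_adj_of_triangle h
  have e : ∀ {a b : V}, (skeleton T).Adj a b →
      edgeLength Φ r a b ^ 2 = sqLen (r a) (r b) (Real.cos (Φ s(a, b))) := fun {a b} hab =>
    Real.sq_sqrt (sqLen_pos (hr a) (hr b) (hΦ.cos_mem hab).1).le
  change Real.arccos ((edgeLength Φ r i j ^ 2 + edgeLength Φ r i k ^ 2 - edgeLength Φ r j k ^ 2)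
        / (2 * edgeLength Φ r i j * edgeLength Φ r i k)) = _
  rw [e hij, e hik, e hjk]
  rfl

theorem edgeConductance_nonneg {T : AbstractSimplicialComplex V} {Φ : Sym2 V → ℝ}
    (hΦ : IsWeight T Φ) {r : V → ℝ} (hr : IsMetric r) {i j k : V}
    (h : (linkGraph T i).Adj j k) : 0 ≤ edgeConductance Φ r i j k := by
  obtain ⟨hjk, hik, hij⟩ := skeleton_adj_of_triangle h
  exact conductance_nonneg (hr i) (hr j) (hr k) (hΦ.cos_mem hjk).1 (hΦ.cos_mem hik).1
    (hΦ.cos_mem hij).1 (hΦ.cos_mem hij).2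

theorem edgeConductance_pos_or {T : AbstractSimplicialComplex V} {Φ : Sym2 V → ℝ}
    (hΦ : IsWeight T Φ) {r : V → ℝ} (hr : IsMetric r) {i j k : V}
    (h : (linkGraph T i).Adj j k) : 0 < edgeConductance Φ r i j k ∨
      (0 < edgeConductance Φ r i k j ∧ 0 < edgeConductance Φ r j k i) := by
  obtain ⟨hjk, hik, hij⟩ := skeleton_adj_of_triangle h
  unfold edgeConductance
  rw [Sym2.eq_swap (a := k) (b := j), Sym2.eq_swap (a := k) (b := i),
    Sym2.eq_swap (a := j) (b := i)]
  exact conductance_pos_or (hr i) (hr j) (hr k) (hΦ.cos_mem hjk).1 (hΦ.cos_mem hik).1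
    (hΦ.cos_mem hij).1 (hΦ.cos_mem hjk).2 (hΦ.cos_mem hik).2 (hΦ.cos_mem hij).2

theorem innerAngle_add_add {T : AbstractSimplicialComplex V} {Φ : Sym2 V → ℝ}
    (hΦ : IsWeight T Φ) {r : V → ℝ} (hr : IsMetric r) {i j k : V}
    (h : (linkGraph T i).Adj j k) :
    innerAngle Φ r i s(j, k) + innerAngle Φ r j s(k, i) + innerAngle Φ r k s(i, j) = Real.pi := by
  obtain ⟨hjk, hik, hij⟩ := skeleton_adj_of_triangle h
  rw [innerAngle_eq_sideAngle hΦ hr h, innerAngle_eq_sideAngle hΦ hr (linkGraph_adj_rotate h),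
    innerAngle_eq_sideAngle hΦ hr (linkGraph_adj_rotate (linkGraph_adj_rotate h)),
    Sym2.eq_swap (a := j) (b := i), Sym2.eq_swap (a := k) (b := i), Sym2.eq_swap (a := k) (b := j),
    sqLen_comm (r j) (r i), sqLen_comm (r k) (r i), sqLen_comm (r k) (r j)]
  rw [sideAngle_swap (sqLen (r i) (r k) _)]
  exact sideAngle_add_add (sqLen_pos (hr j) (hr k) (hΦ.cos_mem hjk).1)
    (sqLen_pos (hr i) (hr k) (hΦ.cos_mem hik).1) (sqLen_pos (hr i) (hr j) (hΦ.cos_mem hij).1)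
    (heron_sqLen_pos (hr i) (hr j) (hr k) (hΦ.cos_mem hjk).1 (hΦ.cos_mem hik).1
    (hΦ.cos_mem hij).1 (hΦ.cos_mem hjk).2 (hΦ.cos_mem hik).2 (hΦ.cos_mem hij).2)

theorem hasDerivAt_innerAngle {T : AbstractSimplicialComplex V} {Φ : Sym2 V → ℝ}
    (hΦ : IsWeight T Φ) (u h : V → ℝ) (t : ℝ) {i j k : V} (hijk : (linkGraph T i).Adj j k) :
    HasDerivAt (fun s : ℝ => innerAngle Φ (expMetric (u + s • h)) i s(j, k))
      (edgeConductance Φ (expMetric (u + t • h)) i j k * (h j - h i) +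
        edgeConductance Φ (expMetric (u + t • h)) i k j * (h k - h i)) t := by
  obtain ⟨hjk, hik, hij⟩ := skeleton_adj_of_triangle hijk
  have hd : ∀ a, HasDerivAt (fun s : ℝ => expMetric (u + s • h) a)
      (expMetric (u + t • h) a * h a) t := by
    intro a
    unfold expMetric
    have := (((hasDerivAt_id t).mul_const (h a)).const_add (u a)).exp
    simpa using this
  have := hasDerivAt_sideAngle_sqLen (hd i) (hd j) (hd k) (Real.exp_pos _) (Real.exp_pos _)
    (Real.exp_pos _) (hΦ.cos_mem hjk).1 (hΦ.cos_mem hik).1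
    (hΦ.cos_mem hij).1 (hΦ.cos_mem hjk).2 (hΦ.cos_mem hik).2 (hΦ.cos_mem hij).2
  simp only [innerAngle_eq_sideAngle hΦ (isMetric_expMetric _) hijk]
  unfold edgeConductance
  rwa [Sym2.eq_swap (a := k) (b := j)]

variable [Fintype V]

/-- Discrete Gauss–Bonnet: the angles of each triangle add up to `π`, so by rotation the angle sum
is `π/3` times the number of ordered triangles, which `eulerChar_eq` relates to `χ`. -/
theorem sum_gaussCurvature {T : AbstractSimplicialComplex V} (hT : IsClosedSurface T)
    {Φ : Sym2 V → ℝ} (hΦ : IsWeight T Φ) {r : V → ℝ} (hr : IsMetric r) :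
    ∑ i, gaussCurvature T Φ r i = 2 * Real.pi * (eulerChar T : ℝ) := by
  have h1 := sum_gaussCurvature_mul T Φ r (fun _ => 1)
  simp only [mul_one] at h1
  have h2 : 3 * triangleSum T (fun i j k => innerAngle Φ r i s(j, k)) =
      Real.pi * triangleSum T (fun _ _ _ => 1) := by
    have e1 := triangleSum_rotate T (fun i j k => innerAngle Φ r i s(j, k))
    have e2 := triangleSum_rotate T (fun i j k => innerAngle Φ r j s(k, i))
    have e3 : triangleSum T (fun _ _ _ => Real.pi * 1) = triangleSum T (fun i j k =>
        innerAngle Φ r i s(j, k) + innerAngle Φ r j s(k, i) + innerAngle Φ r k s(i, j)) :=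
      triangleSum_congr fun i j k h => by rw [innerAngle_add_add hΦ hr h, mul_one]
    rw [← triangleSum_const_mul T Real.pi, e3, triangleSum_add, triangleSum_add]
    linarith
  rw [h1, eulerChar_eq hT]
  simp
  linarith

theorem hasDerivAt_triangleSum {T : AbstractSimplicialComplex V} {F : ℝ → V → V → V → ℝ}
    {F' : V → V → V → ℝ} {t : ℝ}
    (h : ∀ i j k, (linkGraph T i).Adj j k → HasDerivAt (fun s => F s i j k) (F' i j k) t) :
    HasDerivAt (fun s => triangleSum T (F s)) (triangleSum T F') t := by
  unfold triangleSum
  refine HasDerivAt.fun_sum fun i _ => HasDerivAt.fun_sum fun j _ => HasDerivAt.fun_sum fun k _ => ?_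
  split_ifs with hijk
  · exact h i j k hijk
  · exact hasDerivAt_const _ _

/-- The second variation of the discrete Ricci potential, twice. -/
noncomputable def dirichletEnergy (T : AbstractSimplicialComplex V) (Φ : Sym2 V → ℝ)
    (r h : V → ℝ) : ℝ :=
  triangleSum T fun i j k => edgeConductance Φ r i j k * (h i - h j) ^ 2

theorem hasDerivAt_sum_gaussCurvature {T : AbstractSimplicialComplex V} {Φ : Sym2 V → ℝ}
    (hΦ : IsWeight T Φ) (u h : V → ℝ) (t : ℝ) :
    HasDerivAt (fun s : ℝ => ∑ i, gaussCurvature T Φ (expMetric (u + s • h)) i * h i)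
      (2⁻¹ * dirichletEnergy T Φ (expMetric (u + t • h)) h) t := by
  simp only [sum_gaussCurvature_mul]
  have h1 := hasDerivAt_triangleSum (T := T) fun i j k hijk =>
    (hasDerivAt_innerAngle hΦ u h t hijk).mul_const (h i)
  convert! (h1.const_mul 2⁻¹).const_sub (2 * Real.pi * ∑ i, h i) using 1
  rw [← mul_neg]
  congr 1
  -- Discrete Green formula: relabelling gives each edge the two terms `w (h j - h i) h i` and `w (h
  -- i - h j) h j`, which add up to `-w (h i - h j)²` by symmetry of `w`.
  set w := edgeConductance Φ (expMetric (u + t • h))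
  have e1 := triangleSum_swap T (fun i j k => w i j k * (h j - h i) * h i)
  have e2 := triangleSum_swap T (fun i j k => w i j k * (h j - h i) * h i)
  rw [← triangleSum_rotate] at e2
  have e3 : triangleSum T (fun i j k => (w i j k * (h j - h i) + w i k j * (h k - h i)) * h i) =
      triangleSum T (fun i j k => w i j k * (h j - h i) * h i) +
      triangleSum T (fun i j k => w i k j * (h k - h i) * h i) := by
    rw [← triangleSum_add]
    exact triangleSum_congr fun i j k _ => by ring
  have e4 : dirichletEnergy T Φ (expMetric (u + t • h)) h =
      (-1) * (triangleSum T (fun i j k => w i j k * (h j - h i) * h i) +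
      triangleSum T (fun i j k => w j i k * (h i - h j) * h j)) := by
    rw [← triangleSum_add, ← triangleSum_const_mul]
    refine triangleSum_congr fun i j k _ => ?_
    rw [show w j i k = w i j k from edgeConductance_comm _ _ _ _ _]
    ring
  linarith

end CirclePacking

/-! ### Monotonicity and regularity of the flow field. -/

namespace CirclePacking

section Softmax

variable {V : Type*} [Fintype V]

/-- The normalized exponential of a vector. -/
noncomputable def softmax (x : V → ℝ) (i : V) : ℝ := Real.exp (x i) / ∑ j, Real.exp (x j)

theorem sum_exp_pos [Nonempty V] (x : V → ℝ) : 0 < ∑ j, Real.exp (x j) :=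
  Finset.sum_pos (fun _ _ => Real.exp_pos _) Finset.univ_nonempty

theorem softmax_pos [Nonempty V] (x : V → ℝ) (i : V) : 0 < softmax x i :=
  div_pos (Real.exp_pos _) (sum_exp_pos x)

theorem sum_softmax [Nonempty V] (x : V → ℝ) : ∑ i, softmax x i = 1 := by
  unfold softmax
  rw [← Finset.sum_div, div_self (sum_exp_pos x).ne']

theorem softmax_le_one [Nonempty V] (x : V → ℝ) (i : V) : softmax x i ≤ 1 := by
  rw [← sum_softmax x]
  exact Finset.single_le_sum (fun j _ => (softmax_pos x j).le) (Finset.mem_univ i)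

/-- The normalized exponential is a monotone operator. -/
theorem softmax_monotone [Nonempty V] (x y : V → ℝ) :
    0 ≤ ∑ i, (softmax x i - softmax y i) * (x i - y i) := by
  -- Up to an additive constant `z` is the logarithm of its softmax. The constants drop out because
  -- both softmaxes have total one, and what remains is monotonicity of the logarithm.
  have hlog : ∀ (z : V → ℝ) i, z i = Real.log (softmax z i) + Real.log (∑ j, Real.exp (z j)) := by
    intro z i
    unfold softmax
    rw [Real.log_div (Real.exp_pos _).ne' (sum_exp_pos z).ne', Real.log_exp]
    ring
  have key : ∑ i, (softmax x i - softmax y i) * (x i - y i) =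
      ∑ i, (softmax x i - softmax y i) * (Real.log (softmax x i) - Real.log (softmax y i)) := by
    have h0 : ∑ i, (softmax x i - softmax y i) *
        (Real.log (∑ j, Real.exp (x j)) - Real.log (∑ j, Real.exp (y j))) = 0 := by
      rw [← Finset.sum_mul, Finset.sum_sub_distrib, sum_softmax, sum_softmax]
      ring
    rw [← sub_eq_zero, ← Finset.sum_sub_distrib, ← h0]
    refine Finset.sum_congr rfl fun i _ => ?_
    rw [hlog x i, hlog y i]
    ring
  rw [key]
  refine Finset.sum_nonneg fun i _ => ?_
  rcases le_total (softmax x i) (softmax y i) with h | h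
  · exact mul_nonneg_of_nonpos_of_nonpos (by linarith)
      (by linarith [Real.log_le_log (softmax_pos x i) h])
  · exact mul_nonneg (by linarith) (by linarith [Real.log_le_log (softmax_pos y i) h])

theorem contDiff_softmax [Nonempty V] (i : V) : ContDiff ℝ 1 fun x : V → ℝ => softmax x i := by
  unfold softmax
  refine ContDiff.div (by fun_prop) (by fun_prop) fun x => (sum_exp_pos x).ne'

end Softmax

variable {V : Type*}

theorem innerAngle_mem (Φ : Sym2 V → ℝ) (r : V → ℝ) (i : V) (e : Sym2 V) :
    0 ≤ innerAngle Φ r i e ∧ innerAngle Φ r i e ≤ Real.pi := by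
  induction e with
  | h j k => exact ⟨Real.arccos_nonneg _, Real.arccos_le_pi _⟩

variable [Fintype V] [DecidableEq V]

theorem continuous_dirichletEnergy {T : AbstractSimplicialComplex V} {Φ : Sym2 V → ℝ}
    (hΦ : IsWeight T Φ) :
    Continuous fun p : (V → ℝ) × (V → ℝ) => dirichletEnergy T Φ (expMetric p.1) p.2 := by
  unfold dirichletEnergy triangleSum
  refine continuous_finsetSum _ fun i _ => continuous_finsetSum _ fun j _ =>
    continuous_finsetSum _ fun k _ => ?_
  split_ifs with hijk
  · obtain ⟨hjk, hik, hij⟩ := skeleton_adj_of_triangle hijk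
    refine Continuous.mul ?_ (by fun_prop)
    unfold edgeConductance conductance
    refine Continuous.div (by unfold expMetric; fun_prop)
      (by unfold heron sqLen expMetric; fun_prop) fun p => ?_
    have hr := isMetric_expMetric p.1
    exact (mul_pos (sqLen_pos (hr i) (hr j) (hΦ.cos_mem hij).1) (Real.sqrt_pos.mpr
      (heron_sqLen_pos (hr i) (hr j) (hr k) (hΦ.cos_mem hjk).1 (hΦ.cos_mem hik).1
      (hΦ.cos_mem hij).1 (hΦ.cos_mem hjk).2 (hΦ.cos_mem hik).2 (hΦ.cos_mem hij).2))).ne'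
  · exact continuous_const

theorem dirichletEnergy_smul (T : AbstractSimplicialComplex V) (Φ : Sym2 V → ℝ) (r h : V → ℝ)
    (c : ℝ) : dirichletEnergy T Φ r (c • h) = c ^ 2 * dirichletEnergy T Φ r h := by
  unfold dirichletEnergy
  rw [← triangleSum_const_mul]
  refine triangleSum_congr fun i j k _ => ?_
  simp only [Pi.smul_apply, smul_eq_mul]
  ring

theorem dirichletEnergy_nonneg {T : AbstractSimplicialComplex V} {Φ : Sym2 V → ℝ}
    (hΦ : IsWeight T Φ) {r : V → ℝ} (hr : IsMetric r) (h : V → ℝ) :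
    0 ≤ dirichletEnergy T Φ r h :=
  triangleSum_nonneg fun _ _ _ hijk =>
    mul_nonneg (edgeConductance_nonneg hΦ hr hijk) (sq_nonneg _)

/-- Every edge lies in a triangle. If its conductance there vanishes, the other two sides have
positive conductance and join the same endpoints; connectedness does the rest. -/
theorem eq_of_dirichletEnergy_eq_zero {T : AbstractSimplicialComplex V} (hT : IsClosedSurface T)
    {Φ : Sym2 V → ℝ} (hΦ : IsWeight T Φ) {r : V → ℝ} (hr : IsMetric r) {h : V → ℝ}
    (h0 : dirichletEnergy T Φ r h = 0) (i j : V) : h i = h j := by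
  have hterm : ∀ {i j k}, (linkGraph T i).Adj j k → 0 < edgeConductance Φ r i j k → h i = h j := by
    intro i j k hijk hpos
    have := le_triangleSum (F := fun i j k => edgeConductance Φ r i j k * (h i - h j) ^ 2)
      (fun _ _ _ hijk => mul_nonneg (edgeConductance_nonneg hΦ hr hijk) (sq_nonneg _)) hijk
    change _ ≤ dirichletEnergy T Φ r h at this
    rw [h0] at this
    have h2 : (h i - h j) ^ 2 ≤ 0 := nonpos_of_mul_nonpos_right this hpos
    nlinarith [pow_eq_zero_iff (two_ne_zero) |>.mp (le_antisymm h2 (sq_nonneg _))]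
  have hedge : ∀ {i j}, (skeleton T).Adj i j → h i = h j := by
    intro i j hij
    have hne : ((linkGraph T i).neighborSet j).Nonempty := by
      apply Set.nonempty_of_ncard_ne_zero
      rw [hT.link_degree i j hij]
      norm_num
    obtain ⟨k, hk⟩ := hne
    have hk : (linkGraph T i).Adj j k := hk
    rcases edgeConductance_pos_or hΦ hr hk with hp | ⟨hp, hq⟩
    · exact hterm hk hp
    · exact (hterm hk.symm hp).trans (hterm (linkGraph_adj_rotate hk) hq).symm
  obtain ⟨w⟩ := hT.connected.preconnected i j
  induction w with
  | nil => rfl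
  | cons hadj _ ih => exact (hedge hadj).trans ih

/-- The energy is continuous and positive on the compact product of `K` with the unit sphere of
sum-zero vectors, hence bounded below; homogeneity of degree two extends the bound. -/
theorem exists_le_dirichletEnergy {T : AbstractSimplicialComplex V} (hT : IsClosedSurface T)
    {Φ : Sym2 V → ℝ} (hΦ : IsWeight T Φ) {K : Set (V → ℝ)} (hK : IsCompact K) :
    ∃ c > 0, ∀ u ∈ K, ∀ h : V → ℝ, ∑ i, h i = 0 →
      c * ∑ i, h i ^ 2 ≤ dirichletEnergy T Φ (expMetric u) h := by
  have hS : IsCompact {h : V → ℝ | ∑ i, h i = 0 ∧ ∑ i, h i ^ 2 = 1} := by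
    refine (isCompact_closedBall (0 : V → ℝ) 1).of_isClosed_subset ?_ ?_
    · exact (isClosed_eq (by fun_prop) continuous_const).inter
        (isClosed_eq (by fun_prop) continuous_const)
    · rintro h ⟨-, h1⟩
      rw [mem_closedBall_zero_iff, pi_norm_le_iff_of_nonneg zero_le_one]
      intro i
      rw [Real.norm_eq_abs, ← sq_le_one_iff_abs_le_one, ← h1]
      exact Finset.single_le_sum (f := fun i => h i ^ 2) (fun j _ => sq_nonneg _)
        (Finset.mem_univ i)
  obtain ⟨c, hc, hcK⟩ := (hK.prod hS).exists_forall_le'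
    (continuous_dirichletEnergy hΦ).continuousOn (a := 0) (by
      rintro ⟨u, h⟩ ⟨-, hs, h1⟩
      refine (dirichletEnergy_nonneg hΦ (isMetric_expMetric u) h).lt_of_ne fun h0 => ?_
      have hconst := eq_of_dirichletEnergy_eq_zero hT hΦ (isMetric_expMetric u) h0.symm
      have hz : ∀ i, h i = 0 := by
        intro i
        have : ∑ j, h j = Fintype.card V * h i := by
          rw [Finset.sum_congr rfl (fun j _ => hconst j i)]
          simp
        rw [this] at hs
        have hcard : (Fintype.card V : ℝ) ≠ 0 := by
          have : Nonempty V := ⟨i⟩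
          exact_mod_cast Fintype.card_ne_zero
        exact (mul_eq_zero.mp hs).resolve_left hcard
      simp [hz] at h1)
  refine ⟨c, hc, fun u hu h hs => ?_⟩
  rcases (Finset.sum_nonneg fun i _ => sq_nonneg (h i) :
    0 ≤ ∑ i, h i ^ 2).eq_or_lt with h0 | h0
  · rw [← h0, mul_zero]
    exact dirichletEnergy_nonneg hΦ (isMetric_expMetric u) h
  · have hq := Real.sqrt_pos.mpr h0
    have := hcK (u, (√(∑ i, h i ^ 2))⁻¹ • h) ⟨hu, by
      simp [← Finset.mul_sum, hs], by
      simp only [Pi.smul_apply, smul_eq_mul, mul_pow]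
      rw [← Finset.mul_sum, inv_pow, Real.sq_sqrt h0.le, inv_mul_cancel₀ h0.ne']⟩
    rw [dirichletEnergy_smul, inv_pow, Real.sq_sqrt h0.le] at this
    rwa [mul_comm, ← le_div_iff₀' h0, div_eq_inv_mul]

/-- The discrete Gauss curvature is strongly monotone on compact convex sets of logarithmic
radii, transversally to scaling. -/
theorem exists_gaussCurvature_strongMono {T : AbstractSimplicialComplex V}
    (hT : IsClosedSurface T) {Φ : Sym2 V → ℝ} (hΦ : IsWeight T Φ) {K : Set (V → ℝ)}
    (hK : IsCompact K) (hconv : Convex ℝ K) :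
    ∃ c > 0, ∀ u ∈ K, ∀ v ∈ K, ∑ i, v i = ∑ i, u i →
      c * ∑ i, (v i - u i) ^ 2 ≤
        ∑ i, (gaussCurvature T Φ (expMetric v) i - gaussCurvature T Φ (expMetric u) i) *
          (v i - u i) := by
  obtain ⟨c, hc, hcK⟩ := exists_le_dirichletEnergy hT hΦ hK
  refine ⟨2⁻¹ * c, by positivity, fun u hu v hv huv => ?_⟩
  have hd := fun t => hasDerivAt_sum_gaussCurvature hΦ u (v - u) t
  -- Mean value theorem along the segment from `u` to `v`; convexity keeps the intermediate point in
  -- `K`, where the energy bound applies.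
  obtain ⟨t, ht, heq⟩ := exists_hasDerivAt_eq_slope _ _ zero_lt_one
    (fun t _ => (hd t).continuousAt.continuousWithinAt) (fun t _ => hd t)
  have hmem : u + t • (v - u) ∈ K := hconv.add_smul_sub_mem hu hv ⟨ht.1.le, ht.2.le⟩
  have := hcK _ hmem (v - u) (by simp [huv])
  rw [sub_zero, div_one, one_smul, zero_smul, add_zero, add_sub_cancel,
    ← Finset.sum_sub_distrib] at heq
  simp only [Pi.sub_apply, ← sub_mul] at heq this
  rw [← heq]
  linarith

/-- The vector field of the `α`-flow in logarithmic radii. -/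
noncomputable def flowField (T : AbstractSimplicialComplex V) (Φ : Sym2 V → ℝ) (α : ℝ)
    (u : V → ℝ) (i : V) : ℝ :=
  sAlpha T α (expMetric u) * expMetric u i ^ α - gaussCurvature T Φ (expMetric u) i

theorem flowField_eq (T : AbstractSimplicialComplex V) (Φ : Sym2 V → ℝ) (α : ℝ)
    (u : V → ℝ) (i : V) :
    flowField T Φ α u i = 2 * Real.pi * (eulerChar T : ℝ) * softmax (α • u) i -
      gaussCurvature T Φ (expMetric u) i := by
  have h : ∀ i, expMetric u i ^ α = Real.exp ((α • u) i) := by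
    intro i
    unfold expMetric
    rw [← Real.exp_mul, mul_comm]
    rfl
  unfold flowField sAlpha softmax
  simp only [h]
  ring

/-- Both terms have total `2πχ`, the second by Gauss–Bonnet. This is the conservation law for the
product of the radii. -/
theorem sum_flowField {T : AbstractSimplicialComplex V} (hT : IsClosedSurface T)
    {Φ : Sym2 V → ℝ} (hΦ : IsWeight T Φ) (α : ℝ) (u : V → ℝ) :
    ∑ i, flowField T Φ α u i = 0 := by
  have : Nonempty V := hT.connected.nonempty
  simp only [flowField_eq]
  rw [Finset.sum_sub_distrib, ← Finset.mul_sum, sum_softmax,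
    sum_gaussCurvature hT hΦ (isMetric_expMetric u)]
  ring

theorem exists_flowField_strongMono {T : AbstractSimplicialComplex V}
    (hT : IsClosedSurface T) {Φ : Sym2 V → ℝ} (hΦ : IsWeight T Φ) {α : ℝ}
    (hα : α * (eulerChar T : ℝ) ≤ 0) {K : Set (V → ℝ)} (hK : IsCompact K) (hconv : Convex ℝ K) :
    ∃ c > 0, ∀ u ∈ K, ∀ v ∈ K, ∑ i, v i = ∑ i, u i →
      ∑ i, (flowField T Φ α v i - flowField T Φ α u i) * (v i - u i) ≤
        -(c * ∑ i, (v i - u i) ^ 2) := by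
  have : Nonempty V := hT.connected.nonempty
  obtain ⟨c, hc, h⟩ := exists_gaussCurvature_strongMono hT hΦ hK hconv
  refine ⟨c, hc, fun u hu v hv huv => ?_⟩
  have h1 := h u hu v hv huv
  have h2 : 2 * Real.pi * (eulerChar T : ℝ) *
      ∑ i, (softmax (α • v) i - softmax (α • u) i) * (v i - u i) ≤ 0 := by
    rcases eq_or_ne α 0 with rfl | hα0
    · simp
    · have hm := softmax_monotone (α • v) (α • u)
      simp only [Pi.smul_apply, smul_eq_mul, ← mul_sub] at hm
      have e : ∑ i, (softmax (α • v) i - softmax (α • u) i) * (v i - u i) =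
          α⁻¹ * ∑ i, (softmax (α • v) i - softmax (α • u) i) * (α * (v i - u i)) := by
        rw [Finset.mul_sum]
        refine Finset.sum_congr rfl fun i _ => ?_
        field_simp
      -- Monotonicity of softmax concerns `α(v - u)`; dividing by `α` leaves the factor `χ/α`, which
      -- has the sign of `αχ`.
      have hs : (eulerChar T : ℝ) * α⁻¹ ≤ 0 := by
        have : (eulerChar T : ℝ) * α⁻¹ = α * (eulerChar T : ℝ) * (α⁻¹) ^ 2 := by field_simp
        rw [this]
        exact mul_nonpos_of_nonpos_of_nonneg hα (sq_nonneg _)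
      rw [e, show ∀ a b d s : ℝ, a * b * (d * s) = a * ((b * d) * s) by intros; ring]
      exact mul_nonpos_of_nonneg_of_nonpos (by positivity)
        (mul_nonpos_of_nonpos_of_nonneg hs hm)
  have e : ∑ i, (flowField T Φ α v i - flowField T Φ α u i) * (v i - u i) =
      2 * Real.pi * (eulerChar T : ℝ) *
        ∑ i, (softmax (α • v) i - softmax (α • u) i) * (v i - u i) -
      ∑ i, (gaussCurvature T Φ (expMetric v) i - gaussCurvature T Φ (expMetric u) i) *
          (v i - u i) := by
    rw [Finset.mul_sum, ← Finset.sum_sub_distrib]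
    refine Finset.sum_congr rfl fun i _ => ?_
    rw [flowField_eq, flowField_eq]
    ring
  linarith

theorem contDiff_innerAngle {T : AbstractSimplicialComplex V} {Φ : Sym2 V → ℝ}
    (hΦ : IsWeight T Φ) {i j k : V} (hijk : (linkGraph T i).Adj j k) :
    ContDiff ℝ 1 fun u : V → ℝ => innerAngle Φ (expMetric u) i s(j, k) := by
  obtain ⟨hjk, hik, hij⟩ := skeleton_adj_of_triangle hijk
  have hlen : ∀ {a b : V}, (skeleton T).Adj a b → ContDiff ℝ 1 fun u : V → ℝ =>
      sqLen (expMetric u a) (expMetric u b) (Real.cos (Φ s(a, b))) := by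
    intro a b _
    unfold sqLen expMetric
    fun_prop
  have hpos : ∀ {a b : V}, (skeleton T).Adj a b → ∀ u : V → ℝ,
      0 < sqLen (expMetric u a) (expMetric u b) (Real.cos (Φ s(a, b))) := fun hab u =>
    sqLen_pos (isMetric_expMetric u _) (isMetric_expMetric u _) (hΦ.cos_mem hab).1
  have hh : ∀ u : V → ℝ, 0 < heron
      (sqLen (expMetric u j) (expMetric u k) (Real.cos (Φ s(j, k))))
      (sqLen (expMetric u i) (expMetric u k) (Real.cos (Φ s(i, k))))
      (sqLen (expMetric u i) (expMetric u j) (Real.cos (Φ s(i, j)))) := fun u =>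
    heron_sqLen_pos (isMetric_expMetric u i) (isMetric_expMetric u j) (isMetric_expMetric u k)
      (hΦ.cos_mem hjk).1 (hΦ.cos_mem hik).1
      (hΦ.cos_mem hij).1 (hΦ.cos_mem hjk).2 (hΦ.cos_mem hik).2 (hΦ.cos_mem hij).2
  have e : (fun u : V → ℝ => innerAngle Φ (expMetric u) i s(j, k)) = _ :=
    funext fun u => (innerAngle_eq_sideAngle hΦ (isMetric_expMetric u) hijk).trans
      (sideAngle_eq_arctan (hpos hik u) (hpos hij u) (hh u))
  rw [e]
  have hcd : ContDiff ℝ 1 fun u : V → ℝ => heron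
      (sqLen (expMetric u j) (expMetric u k) (Real.cos (Φ s(j, k))))
      (sqLen (expMetric u i) (expMetric u k) (Real.cos (Φ s(i, k))))
      (sqLen (expMetric u i) (expMetric u j) (Real.cos (Φ s(i, j)))) := by
    unfold heron
    exact ((contDiff_const.mul (hlen hik)).mul (hlen hij)).sub
      ((((hlen hik).add (hlen hij)).sub (hlen hjk)).pow 2)
  exact contDiff_const.sub (Real.contDiff_arctan.comp
    ((((hlen hik).add (hlen hij)).sub (hlen hjk)).div (hcd.sqrt fun u => (hh u).ne')
      fun u => (Real.sqrt_pos.mpr (hh u)).ne'))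

theorem contDiff_flowField {T : AbstractSimplicialComplex V} (hT : IsClosedSurface T)
    {Φ : Sym2 V → ℝ} (hΦ : IsWeight T Φ) (α : ℝ) : ContDiff ℝ 1 (flowField T Φ α) := by
  classical
  have : Nonempty V := hT.connected.nonempty
  refine contDiff_pi.mpr fun i => ?_
  simp only [flowField_eq]
  refine (contDiff_const.mul ((contDiff_softmax i).comp (contDiff_const_smul α))).sub ?_
  unfold gaussCurvature
  refine contDiff_const.sub (ContDiff.sum fun e he => ?_)
  induction e with
  | h j k => exact contDiff_innerAngle hΦ (by simpa using he)

theorem exists_norm_flowField_le {T : AbstractSimplicialComplex V} (hT : IsClosedSurface T)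
    (Φ : Sym2 V → ℝ) (α : ℝ) : ∃ L : ℝ, ∀ u, ‖flowField T Φ α u‖ ≤ L := by
  classical
  have : Nonempty V := hT.connected.nonempty
  set M : ℝ := Fintype.card (Sym2 V) * Real.pi
  refine ⟨2 * Real.pi * |(eulerChar T : ℝ)| + (2 * Real.pi + M), fun u => ?_⟩
  have hM : 0 ≤ M := by positivity
  rw [pi_norm_le_iff_of_nonneg (by positivity)]
  intro i
  rw [flowField_eq, Real.norm_eq_abs]
  refine (abs_sub _ _).trans (add_le_add ?_ ?_)
  · rw [abs_mul, abs_mul, abs_of_pos Real.two_pi_pos, abs_of_pos (softmax_pos _ i)]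
    exact mul_le_of_le_one_right (by positivity) (softmax_le_one _ i)
  · unfold gaussCurvature
    refine (abs_sub _ _).trans (add_le_add (abs_of_pos Real.two_pi_pos).le ?_)
    rw [abs_of_nonneg (Finset.sum_nonneg fun e _ => (innerAngle_mem _ _ _ _).1)]
    refine (Finset.sum_le_sum fun e _ => (innerAngle_mem _ _ _ _).2).trans ?_
    rw [Finset.sum_const, nsmul_eq_mul]
    exact mul_le_mul_of_nonneg_right (by exact_mod_cast Finset.card_le_univ _) Real.pi_pos.le

end CirclePacking

/-! ### Auxiliary facts on differential equations and calculus. -/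

/-- A bounded `C¹` vector field has a global integral curve through every point. -/
theorem exists_global_solution_of_bounded {E : Type*} [NormedAddCommGroup E] [NormedSpace ℝ E]
    [FiniteDimensional ℝ E] {f : E → E} (hf : ContDiff ℝ 1 f) {L : ℝ} (hL : ∀ x, ‖f x‖ ≤ L)
    (x : E) : ∃ γ : ℝ → E, γ 0 = x ∧ ∀ t, HasDerivAt γ (f (γ t)) t := by
  have : CompleteSpace E := FiniteDimensional.complete ℝ E
  have hL0 : 0 ≤ L := (norm_nonneg _).trans (hL x)
  have hloc : ∀ a : ℝ, ∃ γ : ℝ → E, γ 0 = x ∧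
      ∀ t ∈ Set.Ioo (-a) a, HasDerivAt γ (f (γ t)) t := by
    intro a
    rcases le_or_gt a 0 with ha | ha
    · exact ⟨fun _ => x, rfl, fun t ht => absurd (ht.1.trans ht.2) (by linarith)⟩
    -- A curve of speed at most `L` stays within `L * a` of `x` up to time `a`, so a Lipschitz
    -- constant on this ball suffices on the whole interval.
    obtain ⟨K, hK⟩ := hf.contDiffOn.exists_lipschitzOnWith (s := Metric.closedBall x (L * a))
      one_ne_zero (convex_closedBall _ _) (isCompact_closedBall _ _)
    have hpl : IsPicardLindelof (fun _ => f) (tmin := -a) (tmax := a)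
        ⟨0, by simp [ha.le]⟩ x (⟨L * a, by positivity⟩) 0 ⟨L, hL0⟩ K := by
      apply IsPicardLindelof.of_time_independent
      · exact fun y _ => hL y
      · exact hK
      · simp; rfl
    obtain ⟨γ, h0, hγ⟩ := hpl.exists_eq_forall_mem_Icc_hasDerivWithinAt₀
    exact ⟨γ, h0, fun t ht =>
      (hγ t (Set.Ioo_subset_Icc_self ht)).hasDerivAt (Icc_mem_nhds ht.1 ht.2)⟩
  -- Solutions on all intervals `(-a, a)` yield a global one; for this, `E` is viewed as a manifold
  -- modelled on itself.
  let v : (y : E) → TangentSpace (modelWithCornersSelf ℝ E) y := f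
  have hv := contMDiff_vectorSpace_iff_contDiff (V := v).mpr hf
  obtain ⟨γ, h0, hγ⟩ := (exists_isMIntegralCurve_iff_exists_isMIntegralCurveOn_Ioo hv x).mpr
    fun a => by
      obtain ⟨γ, h0, hγ⟩ := hloc a
      exact ⟨γ, h0, fun t ht => (hasMFDerivAt_iff_hasFDerivAt.mpr
        (hasDerivAt_iff_hasFDerivAt.mp (hγ t ht))).hasMFDerivWithinAt⟩
  exact ⟨γ, h0, fun t => hasDerivAt_iff_hasFDerivAt.mpr (hasMFDerivAt_iff_hasFDerivAt.mp (hγ t))⟩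

/-- A function with nonpositive derivative on `[0, ∞)` is antitone there. -/
theorem antitoneOn_Ici_of_hasDerivWithinAt_nonpos {f f' : ℝ → ℝ}
    (hf : ∀ t, 0 ≤ t → HasDerivWithinAt f (f' t) (Set.Ici 0) t) (hf' : ∀ t, 0 ≤ t → f' t ≤ 0) :
    AntitoneOn f (Set.Ici 0) := by
  have hd : ∀ t ∈ interior (Set.Ici (0 : ℝ)), HasDerivAt f (f' t) t := fun t ht => by
    rw [interior_Ici] at ht
    exact (hf t (le_of_lt ht)).hasDerivAt (Ici_mem_nhds ht)
  refine antitoneOn_of_deriv_nonpos (convex_Ici 0) (fun t ht => (hf t ht).continuousWithinAt)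
    (fun t ht => (hd t ht).differentiableAt.differentiableWithinAt) fun t ht => ?_
  rw [(hd t ht).deriv]
  exact hf' t (interior_subset ht)

/-- If a function and its derivative both converge at infinity, the derivative tends to zero. -/
theorem eq_zero_of_tendsto_of_hasDerivWithinAt {f f' : ℝ → ℝ} {a m : ℝ}
    (hf : ∀ t, 0 ≤ t → HasDerivWithinAt f (f' t) (Set.Ici 0) t)
    (ha : Filter.Tendsto f Filter.atTop (𝓝 a)) (hm : Filter.Tendsto f' Filter.atTop (𝓝 m)) :
    m = 0 := by
  have hmvt : ∀ t : ℝ, ∃ s, t ≤ s ∧ (0 ≤ t → f' s = f (t + 1) - f t) := by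
    intro t
    by_cases ht : 0 ≤ t
    · obtain ⟨s, hs, h⟩ := exists_hasDerivAt_eq_slope f f' (lt_add_one t)
        (fun s hs => ((hf s (ht.trans hs.1)).continuousWithinAt).mono
          fun y hy => ht.trans hy.1)
        (fun s hs => (hf s (ht.trans hs.1.le)).hasDerivAt (Ici_mem_nhds (ht.trans_lt hs.1)))
      exact ⟨s, hs.1.le, fun _ => by rw [h]; simp⟩
    · exact ⟨t, le_rfl, fun h => absurd h ht⟩
  choose s hs hs' using hmvt
  have h1 : Filter.Tendsto (fun t => f' (s t)) Filter.atTop (𝓝 m) :=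
    hm.comp (Filter.tendsto_atTop_mono hs Filter.tendsto_id)
  have h2 : Filter.Tendsto (fun t => f (t + 1) - f t) Filter.atTop (𝓝 (a - a)) :=
    (ha.comp (Filter.tendsto_atTop_add_const_right _ 1 Filter.tendsto_id)).sub ha
  rw [sub_self] at h2
  refine tendsto_nhds_unique h1 (h2.congr' ?_)
  filter_upwards [Filter.eventually_ge_atTop 0] with t ht using (hs' t ht).symm

theorem abs_exp_sub_exp_le (a b : ℝ) :
    |Real.exp a - Real.exp b| ≤ Real.exp (b + |a - b|) * |a - b| := by
  have key : ∀ x y : ℝ, Real.exp x - Real.exp y ≤ Real.exp x * (x - y) := by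
    intro x y
    have h : Real.exp y = Real.exp x * Real.exp (y - x) := by rw [← Real.exp_add]; ring_nf
    nlinarith [Real.add_one_le_exp (y - x), Real.exp_pos x]
  have ha : a ≤ b + |a - b| := by linarith [le_abs_self (a - b)]
  have hb : b ≤ b + |a - b| := by linarith [abs_nonneg (a - b)]
  rw [abs_sub_le_iff]
  constructor
  · calc Real.exp a - Real.exp b ≤ Real.exp a * (a - b) := key a b
      _ ≤ Real.exp a * |a - b| := by gcongr; exact le_abs_self _
      _ ≤ _ := by gcongr
  · calc Real.exp b - Real.exp a ≤ Real.exp b * (b - a) := key b a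
      _ ≤ Real.exp b * |a - b| := by gcongr; rw [abs_sub_comm]; exact le_abs_self _
      _ ≤ _ := by gcongr

/-! ### Scaling, stationary metrics and long-time behaviour. -/

namespace CirclePacking

section Metric

variable {V : Type*}

theorem expMetric_log {r : V → ℝ} (hr : IsMetric r) :
    expMetric (fun i => Real.log (r i)) = r :=
  funext fun i => Real.exp_log (hr i)

theorem sum_log [Fintype V] {r : V → ℝ} (hr : IsMetric r) :
    ∑ i, Real.log (r i) = Real.log (∏ i, r i) :=
  (Real.log_prod fun i _ => (hr i).ne').symm

theorem prod_expMetric [Fintype V] (u : V → ℝ) :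
    ∏ i, expMetric u i = Real.exp (∑ i, u i) :=
  (Real.exp_sum _ _).symm

theorem innerAngle_smul (Φ : Sym2 V → ℝ) {c : ℝ} (hc : 0 < c) (r : V → ℝ) (i : V) (e : Sym2 V) :
    innerAngle Φ (c • r) i e = innerAngle Φ r i e := by
  have hl : ∀ a b, edgeLength Φ (c • r) a b = c * edgeLength Φ r a b := by
    intro a b
    unfold edgeLength
    rw [← Real.sqrt_sq hc.le, ← Real.sqrt_mul (sq_nonneg c), Real.sqrt_sq hc.le]
    congr 1
    simp only [Pi.smul_apply, smul_eq_mul]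
    ring
  induction e with
  | h j k =>
    change Real.arccos ((edgeLength Φ (c • r) i j ^ 2 + edgeLength Φ (c • r) i k ^ 2 -
        edgeLength Φ (c • r) j k ^ 2) / (2 * edgeLength Φ (c • r) i j * edgeLength Φ (c • r) i k)) =
      Real.arccos ((edgeLength Φ r i j ^ 2 + edgeLength Φ r i k ^ 2 - edgeLength Φ r j k ^ 2)
        / (2 * edgeLength Φ r i j * edgeLength Φ r i k))
    rw [hl, hl, hl, ← mul_div_mul_left _ (2 * edgeLength Φ r i j * edgeLength Φ r i k)
      (pow_pos hc 2).ne']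
    congr 2 <;> ring

theorem ConvergesExponentially.tendsto {r : ℝ → V → ℝ} {r' : V → ℝ}
    (h : ConvergesExponentially r r') : Filter.Tendsto r Filter.atTop (𝓝 r') := by
  obtain ⟨C, c, hc, h⟩ := h
  rw [tendsto_pi_nhds]
  intro i
  rw [tendsto_iff_dist_tendsto_zero]
  have h0 : Filter.Tendsto (fun t : ℝ => C * Real.exp (-(c * t))) Filter.atTop (𝓝 0) := by
    have := (Real.tendsto_exp_neg_atTop_nhds_zero.comp
      (Filter.tendsto_id.const_mul_atTop hc)).const_mul C
    simpa using this
  refine squeeze_zero' (Filter.Eventually.of_forall fun _ => dist_nonneg) ?_ h0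
  filter_upwards [Filter.eventually_ge_atTop 0] with t ht
  exact h t ht i

end Metric

variable {V : Type*} [Fintype V] [DecidableEq V]

theorem gaussCurvature_smul (T : AbstractSimplicialComplex V) (Φ : Sym2 V → ℝ) {c : ℝ}
    (hc : 0 < c) (r : V → ℝ) (i : V) :
    gaussCurvature T Φ (c • r) i = gaussCurvature T Φ r i := by
  unfold gaussCurvature
  simp only [innerAngle_smul Φ hc]

theorem flowField_add_const (T : AbstractSimplicialComplex V) (Φ : Sym2 V → ℝ) (α : ℝ)
    (u : V → ℝ) (b : ℝ) : flowField T Φ α (fun i => u i + b) = flowField T Φ α u := by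
  funext i
  have h1 : expMetric (fun i => u i + b) = Real.exp b • expMetric u := by
    funext j
    simp only [expMetric, Pi.smul_apply, smul_eq_mul, Real.exp_add]
    ring
  have h2 : softmax (α • fun i => u i + b) i = softmax (α • u) i := by
    unfold softmax
    simp only [Pi.smul_apply, smul_eq_mul, mul_add, Real.exp_add]
    rw [← Finset.sum_mul, mul_div_mul_right _ _ (Real.exp_pos _).ne']
  rw [flowField_eq, flowField_eq, h1, h2, gaussCurvature_smul T Φ (Real.exp_pos b)]

/-- Summing `K i = c * r i ^ α` and using Gauss–Bonnet forces the constant `c` to be `s_α`. -/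
theorem isConstantCurvature_iff {T : AbstractSimplicialComplex V} (hT : IsClosedSurface T)
    {Φ : Sym2 V → ℝ} (hΦ : IsWeight T Φ) (α : ℝ) (u : V → ℝ) :
    IsConstantCurvature T Φ α (expMetric u) ↔ flowField T Φ α u = 0 := by
  have : Nonempty V := hT.connected.nonempty
  have hpos : ∀ i, 0 < expMetric u i ^ α := fun i => Real.rpow_pos_of_pos (Real.exp_pos _) _
  have hsum : 0 < ∑ i, expMetric u i ^ α :=
    Finset.sum_pos (fun i _ => hpos i) Finset.univ_nonempty
  constructor
  · rintro ⟨-, c, hc⟩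
    have hK : ∀ i, gaussCurvature T Φ (expMetric u) i = c * expMetric u i ^ α := fun i =>
      (div_eq_iff (hpos i).ne').mp (hc i)
    have hs : sAlpha T α (expMetric u) = c := by
      unfold sAlpha
      rw [← sum_gaussCurvature hT hΦ (isMetric_expMetric u), Finset.sum_congr rfl fun i _ => hK i,
        ← Finset.mul_sum, mul_div_cancel_right₀ _ hsum.ne']
    funext i
    simp [flowField, hs, hK]
  · intro h
    refine ⟨isMetric_expMetric u, sAlpha T α (expMetric u), fun i => ?_⟩
    exact (div_eq_iff (hpos i).ne').mpr (sub_eq_zero.mp (congrFun h i)).symm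

theorem exists_isAlphaFlow {T : AbstractSimplicialComplex V} (hT : IsClosedSurface T)
    {Φ : Sym2 V → ℝ} (hΦ : IsWeight T Φ) (α : ℝ) {r₀ : V → ℝ} (hr₀ : IsMetric r₀) :
    ∃ r : ℝ → V → ℝ, r 0 = r₀ ∧ IsAlphaFlow T Φ α r := by
  obtain ⟨L, hL⟩ := exists_norm_flowField_le hT Φ α
  obtain ⟨γ, h0, hγ⟩ := exists_global_solution_of_bounded (contDiff_flowField hT hΦ α) hL
    (fun i => Real.log (r₀ i))
  refine ⟨fun t => expMetric (γ t), ?_, fun t _ => ⟨isMetric_expMetric _, fun i => ?_⟩⟩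
  · change expMetric (γ 0) = r₀
    rw [h0, expMetric_log hr₀]
  · simp only [expMetric, Real.log_exp]
    exact (hasDerivAt_pi.mp (hγ t) i).hasDerivWithinAt

theorem IsAlphaFlow.hasDerivWithinAt_log {T : AbstractSimplicialComplex V} {Φ : Sym2 V → ℝ}
    {α : ℝ} {r : ℝ → V → ℝ} (hr : IsAlphaFlow T Φ α r) {t : ℝ} (ht : 0 ≤ t) (i : V) :
    HasDerivWithinAt (fun τ => Real.log (r τ i))
      (flowField T Φ α (fun i => Real.log (r t i)) i) (Set.Ici 0) t := by
  unfold flowField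
  rw [expMetric_log (hr t ht).1]
  exact (hr t ht).2 i

theorem IsAlphaFlow.sum_log_eq {T : AbstractSimplicialComplex V} (hT : IsClosedSurface T)
    {Φ : Sym2 V → ℝ} (hΦ : IsWeight T Φ) {α : ℝ} {r : ℝ → V → ℝ} (hr : IsAlphaFlow T Φ α r)
    {t : ℝ} (ht : 0 ≤ t) : ∑ i, Real.log (r t i) = ∑ i, Real.log (r 0 i) := by
  have hd : ∀ s, 0 ≤ s →
      HasDerivWithinAt (fun τ => ∑ i, Real.log (r τ i)) 0 (Set.Ici 0) s := by
    intro s hs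
    have := HasDerivWithinAt.fun_sum (u := Finset.univ)
      fun i _ => hr.hasDerivWithinAt_log hs i
    rwa [sum_flowField hT hΦ] at this
  exact constant_of_has_deriv_right_zero (a := 0) (b := t)
    (fun s hs => (hd s hs.1).continuousWithinAt.mono fun y hy => hy.1)
    (fun s hs => (hd s hs.1).mono (Set.Ici_subset_Ici.mpr hs.1)) t ⟨ht, le_rfl⟩

/-- The flow converges exponentially fast to a zero of its vector field. -/
theorem IsAlphaFlow.convergesExponentially {T : AbstractSimplicialComplex V}
    (hT : IsClosedSurface T) {Φ : Sym2 V → ℝ} (hΦ : IsWeight T Φ) {α : ℝ}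
    (hα : α * (eulerChar T : ℝ) ≤ 0) {r : ℝ → V → ℝ} (hr : IsAlphaFlow T Φ α r) {u : V → ℝ}
    (hu : flowField T Φ α u = 0) (hsum : ∑ i, u i = ∑ i, Real.log (r 0 i)) :
    ConvergesExponentially r (expMetric u) := by
  set U : ℝ → V → ℝ := fun t i => Real.log (r t i) with hU
  set D : ℝ → ℝ := fun t => ∑ i, (U t i - u i) ^ 2 with hDdef
  have hsumU : ∀ t, 0 ≤ t → ∑ i, U t i = ∑ i, u i := fun t ht =>
    (hr.sum_log_eq hT hΦ ht).trans hsum.symm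
  have hD : ∀ t, 0 ≤ t → HasDerivWithinAt D
      (2 * ∑ i, (flowField T Φ α (U t) i - flowField T Φ α u i) * (U t i - u i))
      (Set.Ici 0) t := by
    intro t ht
    rw [Finset.mul_sum]
    refine HasDerivWithinAt.fun_sum fun i _ => ?_
    convert! ((hr.hasDerivWithinAt_log ht i).sub_const (u i)).pow 2 using 1
    simp only [hu, Pi.zero_apply, hU]
    simp
    ring
  have hDnonneg : ∀ t, 0 ≤ D t := fun t => Finset.sum_nonneg fun i _ => sq_nonneg _
  have hDanti : AntitoneOn D (Set.Ici 0) := by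
    refine antitoneOn_Ici_of_hasDerivWithinAt_nonpos hD fun t ht => ?_
    -- The ball, and so `c`, depends on `t`: no uniform compact set is known yet, but the sign of
    -- the derivative is all that is needed here.
    obtain ⟨c, hc, h⟩ := exists_flowField_strongMono hT hΦ hα
      (isCompact_closedBall u (dist (U t) u)) (convex_closedBall _ _)
    have h1 := h u (Metric.mem_closedBall_self dist_nonneg) (U t)
      (Metric.mem_closedBall.mpr le_rfl) (hsumU t ht)
    have h2 : 0 ≤ c * ∑ i, (U t i - u i) ^ 2 := mul_nonneg hc.le (hDnonneg t)
    linarith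
  set R := √(D 0)
  have hle : ∀ t i, |U t i - u i| ≤ √(D t) := fun t i =>
    Real.abs_le_sqrt (Finset.single_le_sum (f := fun i => (U t i - u i) ^ 2)
      (fun _ _ => sq_nonneg _) (Finset.mem_univ i))
  have hball : ∀ t, 0 ≤ t → U t ∈ Metric.closedBall u R := by
    intro t ht
    rw [Metric.mem_closedBall, dist_pi_le_iff (Real.sqrt_nonneg _)]
    exact fun i => (hle t i).trans
      (Real.sqrt_le_sqrt (hDanti Set.self_mem_Ici ht ht))
  -- The trajectory now stays in one fixed ball, so a single `c` serves all times and `D' ≤ -2cD`.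
  obtain ⟨c, hc, hmono⟩ := exists_flowField_strongMono hT hΦ hα
    (isCompact_closedBall u R) (convex_closedBall _ _)
  have hE : AntitoneOn (fun t => D t * Real.exp (2 * c * t)) (Set.Ici 0) := by
    refine antitoneOn_Ici_of_hasDerivWithinAt_nonpos (fun t ht =>
      (hD t ht).mul (((hasDerivAt_id t).const_mul (2 * c)).exp.hasDerivWithinAt)) fun t ht => ?_
    have h1 := hmono u (Metric.mem_closedBall_self (Real.sqrt_nonneg _)) (U t) (hball t ht)
      (hsumU t ht)
    simp only [mul_one, id]
    have h3 : 2 * ∑ i, (flowField T Φ α (U t) i - flowField T Φ α u i) * (U t i - u i) +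
        D t * (2 * c) ≤ 0 := by
      change _ ≤ -(c * D t) at h1
      linarith
    linarith [mul_nonpos_of_nonpos_of_nonneg h3 (Real.exp_pos (2 * c * t)).le]
  have hdecay : ∀ t, 0 ≤ t → √(D t) ≤ R * Real.exp (-(c * t)) := by
    intro t ht
    have h1 := hE Set.self_mem_Ici ht ht
    simp only [mul_zero, Real.exp_zero, mul_one] at h1
    rw [Real.sqrt_le_left (by positivity), mul_pow, Real.sq_sqrt (hDnonneg 0), ← Real.exp_nat_mul]
    rw [show ((2 : ℕ) : ℝ) * -(c * t) = -(2 * c * t) by push_cast; ring, Real.exp_neg,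
      ← div_eq_mul_inv, le_div_iff₀ (Real.exp_pos _)]
    exact h1
  -- The factor `exp (‖u‖ + R)` converts distances of logarithmic radii in the ball into distances
  -- of radii; the other factor `R` is the initial value of `√D`.
  refine ⟨Real.exp (‖u‖ + R) * R, c, hc, fun t ht i => ?_⟩
  have hri : r t i = Real.exp (U t i) := (Real.exp_log ((hr t ht).1 i)).symm
  have hui : u i ≤ ‖u‖ := (le_abs_self _).trans (norm_le_pi_norm u i)
  have hUR : |U t i - u i| ≤ R := (hle t i).trans
    (Real.sqrt_le_sqrt (hDanti Set.self_mem_Ici ht ht))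
  calc |r t i - expMetric u i| = |Real.exp (U t i) - Real.exp (u i)| := by rw [hri]; rfl
    _ ≤ Real.exp (u i + |U t i - u i|) * |U t i - u i| := abs_exp_sub_exp_le _ _
    _ ≤ Real.exp (‖u‖ + R) * (R * Real.exp (-(c * t))) := by
      gcongr
      exact (hle t i).trans (hdecay t ht)
    _ = _ := by ring

/-- The limit of a convergent flow is a zero of the vector field. -/
theorem IsAlphaFlow.exists_flowField_eq_zero {T : AbstractSimplicialComplex V}
    (hT : IsClosedSurface T) {Φ : Sym2 V → ℝ} (hΦ : IsWeight T Φ) {α : ℝ}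
    {r : ℝ → V → ℝ} (hr : IsAlphaFlow T Φ α r) (hconv : FlowConverges r) :
    ∃ u : V → ℝ, flowField T Φ α u = 0 := by
  obtain ⟨r', hr', hlim⟩ := hconv
  have hlog : Filter.Tendsto (fun t i => Real.log (r t i)) Filter.atTop
      (𝓝 fun i => Real.log (r' i)) := by
    rw [tendsto_pi_nhds]
    exact fun i => ((tendsto_pi_nhds.mp hlim) i).log (hr' i).ne'
  have hX := ((contDiff_flowField hT hΦ α).continuous.tendsto (fun i => Real.log (r' i))).comp hlog
  exact ⟨fun i => Real.log (r' i), funext fun i => eq_zero_of_tendsto_of_hasDerivWithinAt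
    (fun t ht => hr.hasDerivWithinAt_log ht i) (tendsto_pi_nhds.mp hlog i)
    (tendsto_pi_nhds.mp hX i)⟩

theorem exists_flowField_eq_zero_sum_eq {T : AbstractSimplicialComplex V}
    (hT : IsClosedSurface T) {Φ : Sym2 V → ℝ} {α : ℝ} {u : V → ℝ}
    (hu : flowField T Φ α u = 0) (s : ℝ) :
    ∃ v : V → ℝ, flowField T Φ α v = 0 ∧ ∑ i, v i = s := by
  have : Nonempty V := hT.connected.nonempty
  refine ⟨fun i => u i + (s - ∑ i, u i) / Fintype.card V, by rw [flowField_add_const, hu], ?_⟩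
  have : (Fintype.card V : ℝ) ≠ 0 := by exact_mod_cast Fintype.card_ne_zero
  rw [Finset.sum_add_distrib, Finset.sum_const, Finset.card_univ, nsmul_eq_mul]
  field_simp
  ring

/-- At two zeros the left side of the strong monotonicity inequality vanishes, so their squared
distance is zero. -/
theorem eq_of_flowField_eq_zero {T : AbstractSimplicialComplex V}
    (hT : IsClosedSurface T) {Φ : Sym2 V → ℝ} (hΦ : IsWeight T Φ) {α : ℝ}
    (hα : α * (eulerChar T : ℝ) ≤ 0) {u v : V → ℝ} (hu : flowField T Φ α u = 0)
    (hv : flowField T Φ α v = 0) (hsum : ∑ i, v i = ∑ i, u i) : v = u := by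
  obtain ⟨c, hc, h⟩ := exists_flowField_strongMono hT hΦ hα
    (isCompact_closedBall u (dist v u)) (convex_closedBall _ _)
  have h1 := h u (Metric.mem_closedBall_self dist_nonneg) v
    (Metric.mem_closedBall.mpr le_rfl) hsum
  simp only [hu, hv, sub_self, zero_mul, Finset.sum_const_zero] at h1
  have h2 : ∑ i, (v i - u i) ^ 2 = 0 :=
    le_antisymm (nonpos_of_mul_nonpos_right (by linarith) hc)
      (Finset.sum_nonneg fun i _ => sq_nonneg _)
  funext i
  have := (Finset.sum_eq_zero_iff_of_nonneg fun i _ => sq_nonneg _).mp h2 i (Finset.mem_univ i)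
  exact sub_eq_zero.mp (pow_eq_zero_iff two_ne_zero |>.mp this)

end CirclePacking

theorem mainTheorem1 {V : Type*} [Fintype V] [DecidableEq V]
    (T : AbstractSimplicialComplex V) (hT : CirclePacking.IsClosedSurface T)
    (Φ : Sym2 V → ℝ) (hΦ : CirclePacking.IsWeight T Φ)
    (α : ℝ) (hα : α * (CirclePacking.eulerChar T : ℝ) ≤ 0)
    (r₀ : V → ℝ) (hr₀ : CirclePacking.IsMetric r₀) :
    (∃ r : ℝ → V → ℝ, r 0 = r₀ ∧ CirclePacking.IsAlphaFlow T Φ α r) ∧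
    ∀ r : ℝ → V → ℝ, r 0 = r₀ → CirclePacking.IsAlphaFlow T Φ α r →
      (CirclePacking.FlowConverges r ↔
        ∃ r' : V → ℝ, CirclePacking.IsConstantCurvature T Φ α r') ∧
      (CirclePacking.FlowConverges r →
        ∃ r' : V → ℝ,
          (CirclePacking.IsConstantCurvature T Φ α r' ∧ ∏ i, r' i = ∏ i, r₀ i) ∧
          (∀ q : V → ℝ, CirclePacking.IsConstantCurvature T Φ α q →
            ∏ i, q i = ∏ i, r₀ i → q = r') ∧
          CirclePacking.ConvergesExponentially r r') := by
  open CirclePacking in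
  refine ⟨exists_isAlphaFlow hT hΦ α hr₀, ?_⟩
  rintro r rfl hr
  have hlog : ∀ {q : V → ℝ}, IsConstantCurvature T Φ α q →
      flowField T Φ α (fun i => Real.log (q i)) = 0 := by
    intro q hq
    rw [← isConstantCurvature_iff hT hΦ, expMetric_log hq.1]
    exact hq
  refine ⟨⟨fun hconv => ?_, ?_⟩, fun hconv => ?_⟩
  · obtain ⟨u, hu⟩ := hr.exists_flowField_eq_zero hT hΦ hconv
    exact ⟨expMetric u, (isConstantCurvature_iff hT hΦ α u).mpr hu⟩
  · rintro ⟨q, hq⟩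
    obtain ⟨v, hv, hsum⟩ := exists_flowField_eq_zero_sum_eq hT (hlog hq) (∑ i, Real.log (r 0 i))
    exact ⟨expMetric v, isMetric_expMetric v,
      (hr.convergesExponentially hT hΦ hα hv hsum).tendsto⟩
  · obtain ⟨u, hu⟩ := hr.exists_flowField_eq_zero hT hΦ hconv
    -- Rescaling the stationary metric to the initial product makes it the target of the exponential
    -- estimate.
    obtain ⟨v, hv, hsum⟩ := exists_flowField_eq_zero_sum_eq hT hu (∑ i, Real.log (r 0 i))
    refine ⟨expMetric v, ⟨(isConstantCurvature_iff hT hΦ α v).mpr hv, ?_⟩, fun q hq hprod => ?_,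
      hr.convergesExponentially hT hΦ hα hv hsum⟩
    · rw [prod_expMetric, hsum, sum_log hr₀, Real.exp_log (Finset.prod_pos fun i _ => hr₀ i)]
    · rw [← expMetric_log hq.1]
      congr 1
      refine eq_of_flowField_eq_zero hT hΦ hα hv (hlog hq) ?_
      rw [sum_log hq.1, hprod, hsum, sum_log hr₀]
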